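/- **Setting.** For every sample size $n\ge 1$ let $p=p_n\ge 1$ and let $X_{1\bullet},\dots,X_{n\bullet}\in\{0,1\}^p$ be i.i.d. draws from the Ising model $$\mathbb P\big(X_{1\bullet}=x\big)\propto\exp\Big\{\sum_j\zeta^*_jx_j+\tfrac12\sum_{j\ne k}\Theta^*_{jk}x_jx_k\Big\},\qquad x\in\{0,1\}^p,$$ with $\zeta^*\in\mathbb R^p$ and $\Theta^*\in\mathbb R^{p\times p}$ symmetric with zero diagonal (both may depend on $n$). Let $G^*$ be the graph on $\{1,\dots,p\}$ whose edges are the pairs $j\neq k$ with $\Theta^*_{jk}\ne0$, and let $\mathcal S_j^*=\{k\ne j:\Theta^*_{jk}\neq0\}$ be the true neighborhood of node $j$. Let $\kappa_n=\log_n(p_n)$ and $\kappa=\limsup_n\kappa_n\in[0,\infty]$, with the convention $1/\infty=0$. For $j\notin S\subset\{1,\dots,p\}$ put $$\mathrm{BIC}_\gamma(S)=-2\sup_{b_0\in\mathbb R,\ b\in\mathbb R^S}\ell_{j,S}(b_0,b)+|S|\log n+2\gamma|S|\log p,$$ where $\ell_{j,S}(b_0,b)=\sum_{i=1}^n\big[X_{ij}\eta_i-\log(1+e^{\eta_i})\big]$,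 $\eta_i=b_0+\sum_{k\in S}b_kX_{ik}$, is the log-likelihood of the logistic regression (with intercept) of node $j$ on the nodes in $S$. **Assumptions.** For fixed constants $q\in\mathbb N$ and $c\in\mathbb R$: (C1) $\log p=o(n)$; (C2) every node of $G^*$ has degree at most $q$; (C3) $\max_j|\zeta^*_j|\le c$ and $\max_{j,k}|\Theta^*_{jk}|\le c$; (C4) $\sqrt{\log(np)/n}=o\big(\min_{(j,k)\in G^*}|\Theta^*_{jk}|\big)$ (a minimum over the empty set being $+\infty$). **Theorem.** (i) Suppose $\kappa>0$ and let $\alpha,\beta,\gamma\in\mathbb R$ satisfy $\gamma>1-\frac1{2\kappa}+\beta+\frac\alpha\kappa$. If $\alpha\ge\frac12$, suppose in addition that $\kappa_n$ converges to $\kappa$. Then, for all sufficiently large $n$, with probability at least $1-n^{-\alpha}p^{-(\beta-1)}$ the inequalities $$\mathrm{BIC}_\gamma(\mathcal S_j^*)<\min\big\{\mathrm{BIC}_\gamma(\mathcal S_j):\mathcal S_j\not\ni j,\ \mathcal S_j\ne\mathcal S_j^*,\ |\mathcal S_j|\le q\big\}-\log(p)\Big(\gamma-\big(1-\tfrac1{2\kappa}+\beta+\tfrac\alpha\kappa\big)\Big)$$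 hold simultaneously for all nodes $j$. (ii) Suppose $\kappa=0$, and let $\alpha\in(0,\frac12)$, $\beta>0$ and $\gamma\in\mathbb R$. Then, for every $M\in\mathbb R$ and all sufficiently large $n$ (depending on $M$), with probability at least $1-n^{-\alpha}p^{-(\beta-1)}$ the inequalities $$\mathrm{BIC}_\gamma(\mathcal S_j^*)<\min\big\{\mathrm{BIC}_\gamma(\mathcal S_j):\mathcal S_j\not\ni j,\ \mathcal S_j\ne\mathcal S_j^*,\ |\mathcal S_j|\le q\big\}-M\log p$$ hold simultaneously for all nodes $j$. (iii) In particular, neighborhood selection with the extended BIC is consistent, simultaneously for all nodes, whenever $\gamma>2-\frac1{2\kappa}$ (any $\gamma\in\mathbb R$ if $\kappa=0$): with probability tending to one, every choice, for all $j$, of a minimizer $\widehat{\mathcal S}_j$ of $\mathrm{BIC}_\gamma$ over $\{\mathcal S_j\not\ni j:|\mathcal S_j|\le q\}$ has $\widehat{\mathcal S}_j=\mathcal S_j^*$ for all $j$, and the graphs built from these neighborhoods by the AND rule and by the OR rule both equal $G^*$. -/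

import Mathlib

open MeasureTheory ProbabilityTheory Filter Topology
open scoped ENNReal

noncomputable section

/-- The numerical value in `{0, 1} ⊆ ℝ` of coordinate `j` of a binary vector `x ∈ {0,1}^p`. -/
def bit {p : ℕ} (x : Fin p → Fin 2) (j : Fin p) : ℝ := ((x j : ℕ) : ℝ)

/-- Unnormalised Ising weight
`exp (∑ j, ζ j * x j + (1/2) * ∑_{j ≠ k} Θ j k * x j * x k)`. -/
def isingWeight {p : ℕ} (ζ : Fin p → ℝ) (Θ : Matrix (Fin p) (Fin p) ℝ)
    (x : Fin p → Fin 2) : ℝ :=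
  Real.exp (∑ j, ζ j * bit x j +
    (1 / 2) * ∑ j, ∑ k, if j ≠ k then Θ j k * bit x j * bit x k else 0)

/-- The probability mass function of the Ising model on `{0,1}^p`. -/
def isingProb {p : ℕ} (ζ : Fin p → ℝ) (Θ : Matrix (Fin p) (Fin p) ℝ)
    (x : Fin p → Fin 2) : ℝ :=
  isingWeight ζ Θ x / ∑ y : Fin p → Fin 2, isingWeight ζ Θ y

/-- The graph whose edges are the pairs `{j, k}`, `j ≠ k`, with a nonzero entry in the
(symmetric) matrix `Θ`. -/
def isingGraph {p : ℕ} (Θ : Matrix (Fin p) (Fin p) ℝ) : SimpleGraph (Fin p) :=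
  SimpleGraph.fromRel fun j k => Θ j k ≠ 0

open Classical in
/-- The neighborhood `{k ≠ j : Θ j k ≠ 0}` of node `j`. -/
def neighborhood {p : ℕ} (Θ : Matrix (Fin p) (Fin p) ℝ) (j : Fin p) : Finset (Fin p) :=
  Finset.univ.filter fun k => k ≠ j ∧ Θ j k ≠ 0

/-- The log-likelihood of the logistic regression of node `j` on the nodes in `S`, for the data
matrix with rows `x i`, at intercept `b₀` and slopes `b k`, `k ∈ S`: the log-odds of
`x i j = 1` are `b₀ + ∑_{k ∈ S} b k * x i k`. -/
def logLik {n p : ℕ} (x : Fin n → Fin p → Fin 2) (j : Fin p) (S : Finset (Fin p))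
    (b₀ : ℝ) (b : Fin p → ℝ) : ℝ :=
  ∑ i, (bit (x i) j * (b₀ + ∑ k ∈ S, b k * bit (x i) k)
    - Real.log (1 + Real.exp (b₀ + ∑ k ∈ S, b k * bit (x i) k)))

/-- The maximized log-likelihood of the regression of node `j` on the nodes in `S` (its value at
the maximum likelihood estimator whenever the latter exists; the log-likelihood is never
positive, so that the supremum is always finite). -/
def maxLogLik {n p : ℕ} (x : Fin n → Fin p → Fin 2) (j : Fin p) (S : Finset (Fin p)) : ℝ :=
  ⨆ b : ℝ × (Fin p → ℝ), logLik x j S b.1 b.2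

/-- The log-likelihood is at most `0`, hence `maxLogLik` is a supremum of a bounded family. -/
theorem logLik_nonpos {n p : ℕ} (x : Fin n → Fin p → Fin 2) (j : Fin p) (S : Finset (Fin p))
    (b₀ : ℝ) (b : Fin p → ℝ) : logLik x j S b₀ b ≤ 0 := by
  refine Finset.sum_nonpos fun i _ => ?_
  set t := b₀ + ∑ k ∈ S, b k * bit (x i) k
  have h1 : t ≤ Real.log (1 + Real.exp t) := by
    rw [Real.le_log_iff_exp_le (by positivity)]; linarith
  have h0 : 0 ≤ Real.log (1 + Real.exp t) :=
    Real.log_nonneg (by linarith [Real.exp_pos t])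
  have hb : bit (x i) j = 0 ∨ bit (x i) j = 1 := by
    unfold bit
    have h2 := (x i j).isLt
    rcases Nat.le_one_iff_eq_zero_or_eq_one.mp (Nat.lt_succ_iff.mp h2) with h | h <;> simp [h]
  rcases hb with h | h <;> rw [h] <;> linarith

/-- The extended Bayesian information criterion
`BIC_γ(S) = -2 * (maximized log-likelihood) + |S| * log n + 2 * γ * |S| * log p`
of the neighborhood `S` of node `j`, for `n` observations of `p` binary variables. -/
def ebic {n p : ℕ} (γ : ℝ) (x : Fin n → Fin p → Fin 2) (j : Fin p) (S : Finset (Fin p)) : ℝ :=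
  -2 * maxLogLik x j S + S.card * Real.log n + 2 * γ * S.card * Real.log p

/-- Candidate neighborhoods of node `j`: sets of at most `q` nodes that do not contain `j`. -/
def IsCandidate {p : ℕ} (q : ℕ) (j : Fin p) (S : Finset (Fin p)) : Prop :=
  j ∉ S ∧ S.card ≤ q

/-- For every node `j`, the neighborhood `S j` beats every other candidate by more than `m`:
`BIC_γ(S j) < min {BIC_γ(T) : j ∉ T, T ≠ S j, |T| ≤ q} - m`. -/
def BeatsBy {n p : ℕ} (γ : ℝ) (q : ℕ) (x : Fin n → Fin p → Fin 2)
    (S : Fin p → Finset (Fin p)) (m : ℝ) : Prop :=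
  ∀ (j : Fin p) (T : Finset (Fin p)), IsCandidate q j T → T ≠ S j →
    ebic γ x j (S j) < ebic γ x j T - m

/-- `S` is a result of neighborhood selection: for every node `j`, the set `S j` minimizes the
extended BIC among all candidate neighborhoods of `j`. -/
def IsSelected {n p : ℕ} (γ : ℝ) (q : ℕ) (x : Fin n → Fin p → Fin 2)
    (S : Fin p → Finset (Fin p)) : Prop :=
  ∀ j, IsCandidate q j (S j) ∧ ∀ T, IsCandidate q j T → ebic γ x j (S j) ≤ ebic γ x j T

/-- The graph formed from neighborhoods by the AND rule. -/
def andGraph {p : ℕ} (S : Fin p → Finset (Fin p)) : SimpleGraph (Fin p) :=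
  SimpleGraph.fromRel fun j k => k ∈ S j ∧ j ∈ S k

/-- The graph formed from neighborhoods by the OR rule. -/
def orGraph {p : ℕ} (S : Fin p → Finset (Fin p)) : SimpleGraph (Fin p) :=
  SimpleGraph.fromRel fun j k => k ∈ S j ∨ j ∈ S k

/-- `κ_n = log_n (p_n) ∈ [0, ∞]`. -/
def kappaSeq (p : ℕ → ℕ) (n : ℕ) : ℝ≥0∞ :=
  ENNReal.ofReal (Real.log (p n) / Real.log n)

/-- `κ = limsup κ_n ∈ [0, ∞]`. -/
def kappa (p : ℕ → ℕ) : ℝ≥0∞ := limsup (kappaSeq p) atTop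

/-- For `κ ∈ (0, ∞]`, the number `1/κ ∈ [0, ∞)`, with `1/∞ = 0`. -/
def invKappa (p : ℕ → ℕ) : ℝ := ((kappa p)⁻¹).toReal

end

/-! Fix a node `j`, let θ be its true conditional log-odds parameter (`nodeParam`), and put L = log
n + log p, u = √(L / n). The central fact is exact: given the other nodes, the likelihood ratio of a
fixed logistic model θ + d against θ has mean one (`sum_isingProb_mul_exp_gain_le`). By Markov, its
logarithm over the sample exceeds s with probability at most exp (-s), with no loss in the constant
(`measureReal_totalGain_gt_le`).

Far from θ, concavity decides. All needed patterns on at most 2q nodes have frequency bounded below,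
so the log-likelihood has curvature of order n, while each score coordinate is O(√(n L)). At
distance W u with W large, the log-likelihood has therefore dropped by C L, for any prescribed C,
and by concavity it stays that low further out (`totalGain_le_of_far`). A candidate that misses a
true neighbor k is at distance at least |Θ j k|, which exceeds W u by (C4). The drop then outweighs
every penalty difference, these being O(L).

A candidate with r ≥ 1 superfluous nodes and no missing one can come close to θ. In the cube of
radius W u the log-likelihood is controlled on a net whose size depends neither on n nor on p,
because moving to a net point costs at most η L. The union over nodes and sets R of r extra nodes
costs p^(1+r), against exp of minus r (log n + 2γ log p) / 2. Comparing this with n^(-α) p^(-(β-1))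
at r = 1 gives the threshold for γ, where 1/κ stands for the limiting log n / log p; larger r is
easier. The strict inequality for γ leaves a slack of order L (`exists_slack`), which pays for the
net. The deterministic argument is assembled in `beatsBy_of_good`, and the probabilities in
`le_measureReal_beatsBy`. -/

/-! ### Convexity estimates for the logistic cumulant function -/

/-- The function `log (1 + exp t)`, the cumulant function of logistic regression. -/
noncomputable def softplus (t : ℝ) : ℝ := Real.log (1 + Real.exp t)

/-- The logistic function `exp t / (1 + exp t)`. -/
noncomputable def logistic (t : ℝ) : ℝ := Real.exp t / (1 + Real.exp t)

theorem logistic_pos (t : ℝ) : 0 < logistic t := by unfold logistic; positivity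

theorem logistic_lt_one (t : ℝ) : logistic t < 1 := by
  unfold logistic
  rw [div_lt_one (by positivity)]
  linarith

theorem one_sub_logistic (t : ℝ) : 1 - logistic t = 1 / (1 + Real.exp t) := by
  unfold logistic
  have := Real.exp_pos t
  field_simp
  ring

/-- Increments of `softplus` are the cumulant generating function of a Bernoulli variable with
success probability `logistic t`, so bounds on moment generating functions apply. -/
theorem softplus_add_sub (t r : ℝ) :
    softplus (t + r) - softplus t = Real.log (1 - logistic t + logistic t * Real.exp r) := by
  have := Real.exp_pos t
  have := Real.exp_pos r
  unfold softplus
  rw [one_sub_logistic, ← Real.log_div (by positivity) (by positivity)]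
  congr 1
  unfold logistic
  rw [Real.exp_add]
  field_simp

/-- The right side of `h` is the moment generating function of the centred Bernoulli variable.
Centring removes the linear term, so that only second-order information about `exp` is needed
afterwards. -/
theorem exp_mul_le_mix {s r y : ℝ} (h : Real.exp y ≤ (1 - s) * Real.exp (-(s * r))
    + s * Real.exp ((1 - s) * r)) : s * r + y ≤ Real.log (1 - s + s * Real.exp r) := by
  have e1 : Real.exp (-(s * r)) * Real.exp (s * r) = 1 := by
    rw [← Real.exp_add]; simp
  have e2 : Real.exp ((1 - s) * r) * Real.exp (s * r) = Real.exp r := by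
    rw [← Real.exp_add]; ring_nf
  have h2 : Real.exp (s * r + y) ≤ 1 - s + s * Real.exp r := by
    calc Real.exp (s * r + y) = Real.exp y * Real.exp (s * r) := by rw [← Real.exp_add]; ring_nf
      _ ≤ ((1 - s) * Real.exp (-(s * r)) + s * Real.exp ((1 - s) * r)) * Real.exp (s * r) := by
        gcongr
      _ = (1 - s) * (Real.exp (-(s * r)) * Real.exp (s * r))
          + s * (Real.exp ((1 - s) * r) * Real.exp (s * r)) := by ring
      _ = _ := by rw [e1, e2]; ring
  rwa [Real.le_log_iff_exp_le (lt_of_lt_of_le (Real.exp_pos _) h2)]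

theorem logistic_mul_le_softplus_sub (t r : ℝ) :
    logistic t * r ≤ softplus (t + r) - softplus t := by
  rw [softplus_add_sub]
  have h0 := logistic_pos t
  have h1 := logistic_lt_one t
  generalize logistic t = s at *
  have := exp_mul_le_mix (s := s) (r := r) (y := 0) ?_
  · simpa using this
  · rw [Real.exp_zero]
    have a1 := Real.add_one_le_exp (-(s * r))
    have a2 := Real.add_one_le_exp ((1 - s) * r)
    nlinarith

/-- The third-order Taylor remainder is at most (2/9) |x|³ ≤ (2/9) x², and 1/2 - 2/9 ≥ 1/4. -/
theorem quadratic_le_exp {x : ℝ} (hx : |x| ≤ 1) : 1 + x + x ^ 2 / 4 ≤ Real.exp x := by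
  have h2 := Real.exp_bound hx (n := 3) (by norm_num)
  rw [abs_le] at h2
  simp [Finset.sum_range_succ, Nat.factorial] at h2
  have h3 : |x| ^ 3 ≤ x ^ 2 := by
    rw [pow_succ, sq_abs]; nlinarith [sq_nonneg x, abs_nonneg x]
  nlinarith [h2.1]

theorem half_le_log_one_add {y : ℝ} (h0 : 0 ≤ y) (h1 : y ≤ 1) : y / 2 ≤ Real.log (1 + y) := by
  rw [Real.le_log_iff_exp_le (by linarith)]
  have := Real.exp_bound' (x := y / 2) (by linarith) (by linarith) (n := 2) (by norm_num)
  simp [Finset.sum_range_succ, Nat.factorial] at this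
  nlinarith

/-- Averaging `quadratic_le_exp` over the centred Bernoulli variable gives 1 + v r²/4, with v its
variance; taking the logarithm by `half_le_log_one_add` halves the quadratic term. -/
theorem softplus_strongly_convex (t r : ℝ) (hr : |r| ≤ 1) :
    logistic t * r + logistic t * (1 - logistic t) / 8 * r ^ 2 ≤ softplus (t + r) - softplus t := by
  rw [softplus_add_sub]
  have h0 := logistic_pos t
  have h1 := logistic_lt_one t
  generalize logistic t = s at *
  apply exp_mul_le_mix
  have hr2 : r ^ 2 ≤ 1 := by rw [← sq_abs]; nlinarith [abs_nonneg r]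
  have a1 := quadratic_le_exp (x := -(s * r)) (by
    rw [abs_neg, abs_mul, abs_of_pos h0]; nlinarith [abs_nonneg r])
  have a2 := quadratic_le_exp (x := (1 - s) * r) (by
    rw [abs_mul, abs_of_pos (by linarith)]; nlinarith [abs_nonneg r])
  have hv : 0 ≤ s * (1 - s) := by nlinarith
  have hv1 : s * (1 - s) ≤ 1 := by nlinarith
  have hy0 : 0 ≤ s * (1 - s) / 4 * r ^ 2 := by positivity
  have hy1 : s * (1 - s) / 4 * r ^ 2 ≤ 1 := by nlinarith
  have h3 := half_le_log_one_add hy0 hy1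
  have h4 : Real.exp (s * (1 - s) / 8 * r ^ 2) ≤ 1 + s * (1 - s) / 4 * r ^ 2 := by
    rw [← Real.le_log_iff_exp_le (by linarith)]
    linarith
  refine h4.trans ?_
  nlinarith [mul_le_mul_of_nonneg_left a1 (by linarith : 0 ≤ 1 - s),
    mul_le_mul_of_nonneg_left a2 h0.le]

theorem softplus_sub_le (t r : ℝ) (hr : |r| ≤ 1) :
    softplus (t + r) - softplus t ≤ logistic t * r + r ^ 2 := by
  rw [softplus_add_sub]
  have h0 := logistic_pos t
  have h1 := logistic_lt_one t
  generalize logistic t = s at *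
  have hpos : 0 < 1 - s + s * Real.exp r := by have := Real.exp_pos r; nlinarith
  have h2 := Real.log_le_sub_one_of_pos hpos
  have h3 := Real.abs_exp_sub_one_sub_id_le hr
  rw [abs_le] at h3
  nlinarith [sq_nonneg r]

theorem logistic_sub_le (t r : ℝ) : |logistic (t + r) - logistic t| ≤ |r| := by
  have key : ∀ t r : ℝ, 0 ≤ r → |logistic (t + r) - logistic t| ≤ r := by
    intro t r hr
    have p1 := Real.exp_pos t
    have p2 := Real.exp_pos (t + r)
    have hle : Real.exp t ≤ Real.exp (t + r) := Real.exp_le_exp.2 (by linarith)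
    have e : logistic (t + r) - logistic t
        = (Real.exp (t + r) - Real.exp t) / ((1 + Real.exp (t + r)) * (1 + Real.exp t)) := by
      unfold logistic; field_simp; ring
    rw [e, abs_of_nonneg (div_nonneg (by linarith) (by positivity)), div_le_iff₀ (by positivity)]
    have h1 : Real.exp t = Real.exp (t + r) * Real.exp (-r) := by rw [← Real.exp_add]; ring_nf
    have h2 := Real.add_one_le_exp (-r)
    nlinarith [mul_nonneg hr p1.le, mul_nonneg (mul_nonneg hr p1.le) p2.le,
      mul_le_mul_of_nonneg_left h2 p2.le]
  rcases le_total 0 r with hr | hr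
  · rw [abs_of_nonneg hr]; exact key t r hr
  · have := key (t + r) (-r) (by linarith)
    rw [abs_of_nonpos hr, abs_sub_comm]
    simpa using this

theorem logistic_variance_ge {t M : ℝ} (ht : |t| ≤ M) :
    Real.exp (-M) / 4 ≤ logistic t * (1 - logistic t) := by
  have p1 := Real.exp_pos t
  have pM := Real.exp_pos M
  rw [abs_le] at ht
  rw [one_sub_logistic, Real.exp_neg]
  unfold logistic
  have a1 : Real.exp t ≤ Real.exp M := Real.exp_le_exp.2 ht.2
  have a2 : 1 ≤ Real.exp M * Real.exp t := by
    rw [← Real.exp_add]; exact Real.one_le_exp (by linarith)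
  have a3 : 1 ≤ Real.exp M := Real.one_le_exp (by linarith)
  have : Real.exp t / (1 + Real.exp t) * (1 / (1 + Real.exp t))
      = Real.exp t / (1 + Real.exp t) ^ 2 := by field_simp
  rw [this, inv_eq_one_div, div_div, div_le_div_iff₀ (by positivity) (by positivity)]
  nlinarith [mul_le_mul_of_nonneg_left a1 p1.le, mul_le_mul_of_nonneg_right a3 p1.le]

/-! ### Linear predictors and scores -/

/-- The linear predictor with intercept `d.1` and slopes `d.2`. -/
noncomputable def linPred {p : ℕ} (d : ℝ × (Fin p → ℝ)) (x : Fin p → Fin 2) : ℝ :=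
  d.1 + ∑ k, d.2 k * bit x k

/-- The contribution of the observation `x` to the log-likelihood ratio of the logistic
regressions of node `j` with parameters `θ + d` and `θ`. -/
noncomputable def gain {p : ℕ} (θ : ℝ × (Fin p → ℝ)) (j : Fin p) (d : ℝ × (Fin p → ℝ))
    (x : Fin p → Fin 2) : ℝ :=
  bit x j * linPred d x - (softplus (linPred θ x + linPred d x) - softplus (linPred θ x))

/-- The log-likelihood ratio of the parameters `θ + d` and `θ` for the sample `x`. -/
noncomputable def totalGain {n p : ℕ} (θ : ℝ × (Fin p → ℝ)) (j : Fin p) (d : ℝ × (Fin p → ℝ))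
    (x : Fin n → Fin p → Fin 2) : ℝ :=
  ∑ i, gain θ j d (x i)

/-- The derivative at `θ` of the log-likelihood in direction `d`. -/
noncomputable def score {n p : ℕ} (θ : ℝ × (Fin p → ℝ)) (j : Fin p) (x : Fin n → Fin p → Fin 2)
    (d : ℝ × (Fin p → ℝ)) : ℝ :=
  ∑ i, (bit (x i) j - logistic (linPred θ (x i))) * linPred d (x i)

section LinPred

variable {n p : ℕ}

theorem bit_eq_zero_or_one (x : Fin p → Fin 2) (j : Fin p) : bit x j = 0 ∨ bit x j = 1 := by
  unfold bit
  generalize x j = a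
  fin_cases a <;> simp

theorem bit_nonneg (x : Fin p → Fin 2) (j : Fin p) : 0 ≤ bit x j := by
  rcases bit_eq_zero_or_one x j with h | h <;> simp [h]

theorem bit_le_one (x : Fin p → Fin 2) (j : Fin p) : bit x j ≤ 1 := by
  rcases bit_eq_zero_or_one x j with h | h <;> simp [h]

theorem linPred_add (d e : ℝ × (Fin p → ℝ)) (x : Fin p → Fin 2) :
    linPred (d + e) x = linPred d x + linPred e x := by
  simp only [linPred, Prod.fst_add, Prod.snd_add, Pi.add_apply, add_mul, Finset.sum_add_distrib]
  ring

theorem linPred_smul (a : ℝ) (d : ℝ × (Fin p → ℝ)) (x : Fin p → Fin 2) :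
    linPred (a • d) x = a * linPred d x := by
  simp only [linPred, Prod.smul_fst, Prod.smul_snd, Pi.smul_apply, smul_eq_mul, mul_add,
    Finset.mul_sum, mul_assoc]

theorem linPred_sub (d e : ℝ × (Fin p → ℝ)) (x : Fin p → Fin 2) :
    linPred (d - e) x = linPred d x - linPred e x := by
  have := linPred_add (d - e) e x
  rw [sub_add_cancel] at this
  linarith

theorem sum_abs_le_of_support {U : Finset (Fin p)} {m : ℕ} (hU : U.card ≤ m) {f : Fin p → ℝ}
    (hf : ∀ k ∉ U, f k = 0) {τ : ℝ} (hτ : 0 ≤ τ) (hfτ : ∀ k, |f k| ≤ τ) :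
    |∑ k, f k| ≤ m * τ := by
  rw [← Finset.sum_subset (Finset.subset_univ U) fun k _ hk => hf k hk]
  calc |∑ k ∈ U, f k| ≤ ∑ k ∈ U, |f k| := Finset.abs_sum_le_sum_abs _ _
    _ ≤ U.card • τ := Finset.sum_le_card_nsmul _ _ _ fun k _ => hfτ k
    _ ≤ m * τ := by
      rw [nsmul_eq_mul]
      exact mul_le_mul_of_nonneg_right (by exact_mod_cast hU) hτ

theorem abs_snd_le_norm (d : ℝ × (Fin p → ℝ)) (k : Fin p) : |d.2 k| ≤ ‖d‖ :=
  (norm_le_pi_norm d.2 k).trans (norm_snd_le d)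

theorem abs_linPred_le {U : Finset (Fin p)} {m : ℕ} (hU : U.card ≤ m) {d : ℝ × (Fin p → ℝ)}
    (hd : ∀ k ∉ U, d.2 k = 0) (x : Fin p → Fin 2) : |linPred d x| ≤ (m + 1) * ‖d‖ := by
  have h2 := sum_abs_le_of_support hU (f := fun k => d.2 k * bit x k)
    (fun k hk => by simp [hd k hk]) (norm_nonneg d) fun k => by
      rw [abs_mul, abs_of_nonneg (bit_nonneg x k)]
      nlinarith [abs_snd_le_norm d k, bit_le_one x k, bit_nonneg x k, abs_nonneg (d.2 k)]
  have h1 : |d.1| ≤ ‖d‖ := norm_fst_le d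
  refine (abs_add_le _ _).trans ?_
  linarith

theorem score_smul (θ : ℝ × (Fin p → ℝ)) (j : Fin p) (x : Fin n → Fin p → Fin 2)
    (a : ℝ) (d : ℝ × (Fin p → ℝ)) : score θ j x (a • d) = a * score θ j x d := by
  simp only [score, linPred_smul, Finset.mul_sum]
  exact Finset.sum_congr rfl fun i _ => by ring

theorem linPred_intercept (a : ℝ) (x : Fin p → Fin 2) : linPred (a, 0) x = a := by
  simp [linPred]

theorem linPred_single (a : ℝ) (k : Fin p) (x : Fin p → Fin 2) :
    linPred (0, Pi.single k a) x = a * bit x k := by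
  simp [linPred, Pi.single_apply]

theorem score_eq (θ : ℝ × (Fin p → ℝ)) (j : Fin p) (x : Fin n → Fin p → Fin 2)
    (d : ℝ × (Fin p → ℝ)) :
    score θ j x d = d.1 * score θ j x (1, 0) + ∑ k, d.2 k * score θ j x (0, Pi.single k 1) := by
  simp only [score, linPred_intercept, linPred_single, Finset.mul_sum]
  rw [Finset.sum_comm, ← Finset.sum_add_distrib]
  refine Finset.sum_congr rfl fun i _ => ?_
  rw [show linPred d (x i) = d.1 + ∑ k, d.2 k * bit (x i) k from rfl, mul_add, Finset.mul_sum]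
  congr 1
  · ring
  · exact Finset.sum_congr rfl fun k _ => by ring

/-- All coordinates of the score at `θ` that belong to the intercept and to nodes other than `j`
are at most `G`. -/
def ScoreBound (θ : ℝ × (Fin p → ℝ)) (j : Fin p) (x : Fin n → Fin p → Fin 2) (G : ℝ) : Prop :=
  |score θ j x (1, 0)| ≤ G ∧ ∀ k ≠ j, |score θ j x (0, Pi.single k 1)| ≤ G

theorem ScoreBound.abs_score_le {θ : ℝ × (Fin p → ℝ)} {j : Fin p} {x : Fin n → Fin p → Fin 2}
    {G : ℝ} (hG : ScoreBound θ j x G) {U : Finset (Fin p)} (hj : j ∉ U) {m : ℕ} (hU : U.card ≤ m)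
    {d : ℝ × (Fin p → ℝ)} (hd : ∀ k ∉ U, d.2 k = 0) :
    |score θ j x d| ≤ (m + 1) * (‖d‖ * G) := by
  have hG0 : 0 ≤ G := (abs_nonneg _).trans hG.1
  have hn := norm_nonneg d
  rw [score_eq]
  have h2 := sum_abs_le_of_support hU
    (f := fun k => d.2 k * score θ j x (0, Pi.single k 1))
    (fun k hk => by simp [hd k hk]) (mul_nonneg hn hG0) fun k => by
      rw [abs_mul]
      by_cases hk : k ∈ U
      · exact mul_le_mul (abs_snd_le_norm d k) (hG.2 k fun h => hj (h ▸ hk)) (abs_nonneg _) hn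
      · simp only [hd k hk, abs_zero, zero_mul]; positivity
  have h1 : |d.1 * score θ j x (1, 0)| ≤ ‖d‖ * G := by
    rw [abs_mul]
    exact mul_le_mul (norm_fst_le d) hG.1 (abs_nonneg _) hn
  refine (abs_add_le _ _).trans ?_
  linarith

end LinPred

/-! ### Log-likelihood ratios: concavity, curvature and their relation to the score -/

section Gain

variable {n p : ℕ} {θ : ℝ × (Fin p → ℝ)} {j : Fin p}

/-- The constant is the 1/8 of `softplus_strongly_convex` times the variance bound exp (-M) / 4. -/
theorem gain_le (d : ℝ × (Fin p → ℝ)) {x : Fin p → Fin 2} {M : ℝ} (hM : |linPred θ x| ≤ M)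
    (hd : |linPred d x| ≤ 1) :
    gain θ j d x ≤ (bit x j - logistic (linPred θ x)) * linPred d x
      - Real.exp (-M) / 32 * linPred d x ^ 2 := by
  have h1 := softplus_strongly_convex (linPred θ x) _ hd
  have h2 := mul_le_mul_of_nonneg_right (logistic_variance_ge hM) (sq_nonneg (linPred d x))
  unfold gain
  linarith

theorem le_gain (d : ℝ × (Fin p → ℝ)) {x : Fin p → Fin 2} (hd : |linPred d x| ≤ 1) :
    (bit x j - logistic (linPred θ x)) * linPred d x - linPred d x ^ 2 ≤ gain θ j d x := by
  have h1 := softplus_sub_le (linPred θ x) _ hd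
  unfold gain
  linarith

/-- Concavity along the ray from θ, where the gain vanishes; the two tangent inequalities at `t + a
* r` are averaged with weights `1 - a` and `a`. -/
theorem mul_gain_le (d : ℝ × (Fin p → ℝ)) (x : Fin p → Fin 2) {a : ℝ} (h0 : 0 ≤ a)
    (h1 : a ≤ 1) : a * gain θ j d x ≤ gain θ j (a • d) x := by
  unfold gain
  rw [linPred_smul]
  set r := linPred d x
  set t := linPred θ x
  have e1 := logistic_mul_le_softplus_sub (t + a * r) (-(a * r))
  have e2 := logistic_mul_le_softplus_sub (t + a * r) ((1 - a) * r)
  have s1 : t + a * r + -(a * r) = t := by ring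
  have s2 : t + a * r + (1 - a) * r = t + r := by ring
  rw [s1] at e1
  rw [s2] at e2
  nlinarith [mul_le_mul_of_nonneg_left e1 (by linarith : 0 ≤ 1 - a),
    mul_le_mul_of_nonneg_left e2 h0]

/-- The tangent at θ + e bounds the increment; moving its slope back to θ costs a Lipschitz term.
Thus the score at θ alone controls the variation everywhere nearby. -/
theorem gain_sub_le (d e : ℝ × (Fin p → ℝ)) (x : Fin p → Fin 2) :
    gain θ j d x - gain θ j e x ≤ (bit x j - logistic (linPred θ x)) * linPred (d - e) x
      + |linPred e x| * |linPred (d - e) x| := by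
  unfold gain
  rw [linPred_sub]
  set r := linPred d x
  set s := linPred e x
  set t := linPred θ x
  have e1 := logistic_mul_le_softplus_sub (t + s) (r - s)
  rw [show t + s + (r - s) = t + r by ring] at e1
  have e2 : (logistic t - logistic (t + s)) * (r - s) ≤ |s| * |r - s| := by
    refine (le_abs_self _).trans ?_
    rw [abs_mul, abs_sub_comm]
    exact mul_le_mul_of_nonneg_right (logistic_sub_le t s) (abs_nonneg _)
  linarith

theorem mul_totalGain_le (d : ℝ × (Fin p → ℝ)) (x : Fin n → Fin p → Fin 2) {a : ℝ} (h0 : 0 ≤ a)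
    (h1 : a ≤ 1) : a * totalGain θ j d x ≤ totalGain θ j (a • d) x := by
  unfold totalGain
  rw [Finset.mul_sum]
  exact Finset.sum_le_sum fun i _ => mul_gain_le d (x i) h0 h1

theorem totalGain_le (d : ℝ × (Fin p → ℝ)) {x : Fin n → Fin p → Fin 2} {M : ℝ}
    (hM : ∀ x, |linPred θ x| ≤ M) (hd : ∀ x, |linPred d x| ≤ 1) :
    totalGain θ j d x ≤ score θ j x d - Real.exp (-M) / 32 * ∑ i, linPred d (x i) ^ 2 := by
  unfold totalGain score
  rw [Finset.mul_sum, ← Finset.sum_sub_distrib]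
  exact Finset.sum_le_sum fun i _ => gain_le d (hM _) (hd _)

theorem score_le_totalGain_add (d : ℝ × (Fin p → ℝ)) {x : Fin n → Fin p → Fin 2} {τ : ℝ}
    (hd : ∀ x, |linPred d x| ≤ τ) (hτ : τ ≤ 1) :
    score θ j x d ≤ totalGain θ j d x + n * τ ^ 2 := by
  have h : ∀ i, (bit (x i) j - logistic (linPred θ (x i))) * linPred d (x i)
      ≤ gain θ j d (x i) + τ ^ 2 := fun i => by
    have h1 := le_gain (θ := θ) (j := j) d ((hd (x i)).trans hτ)
    have h2 : linPred d (x i) ^ 2 ≤ τ ^ 2 := by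
      rw [← sq_abs]; exact pow_le_pow_left₀ (abs_nonneg _) (hd _) 2
    linarith
  refine (Finset.sum_le_sum fun i _ => h i).trans ?_
  simp [totalGain, Finset.sum_add_distrib]

theorem totalGain_sub_le (d e : ℝ × (Fin p → ℝ)) (x : Fin n → Fin p → Fin 2) {a b : ℝ}
    (hb : ∀ x, |linPred e x| ≤ a) (hd : ∀ x, |linPred (d - e) x| ≤ b) :
    totalGain θ j d x - totalGain θ j e x ≤ score θ j x (d - e) + n * (a * b) := by
  have h : ∀ i, gain θ j d (x i) - gain θ j e (x i)
      ≤ (bit (x i) j - logistic (linPred θ (x i))) * linPred (d - e) (x i) + a * b := fun i => by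
    have h1 := gain_sub_le (θ := θ) (j := j) d e (x i)
    have h2 : |linPred e (x i)| * |linPred (d - e) (x i)| ≤ a * b :=
      mul_le_mul (hb _) (hd _) (abs_nonneg _) ((abs_nonneg _).trans (hb (x i)))
    linarith
  unfold totalGain
  rw [← Finset.sum_sub_distrib]
  refine (Finset.sum_le_sum fun i _ => h i).trans ?_
  simp [score, Finset.sum_add_distrib]

/-- The score is controlled by the likelihood ratios at a small distance from `θ`. -/
theorem scoreBound_of_totalGain {x : Fin n → Fin p → Fin 2} {a u : ℝ} (ha : 0 < a) (hu : 0 < u)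
    (hau : a * u ≤ 1)
    (h : ∀ s ∈ ({a * u, -(a * u)} : Finset ℝ), totalGain θ j (s, 0) x ≤ a ^ 2 * u ^ 2 * n ∧
      ∀ k ≠ j, totalGain θ j (0, Pi.single k s) x ≤ a ^ 2 * u ^ 2 * n) :
    ScoreBound θ j x (2 * a * u * n) := by
  have hpos : 0 < a * u := mul_pos ha hu
  have key : ∀ d : ℝ × (Fin p → ℝ), (∀ x, |linPred d x| ≤ 1) →
      totalGain θ j ((a * u) • d) x ≤ a ^ 2 * u ^ 2 * n →
      totalGain θ j ((-(a * u)) • d) x ≤ a ^ 2 * u ^ 2 * n →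
      |score θ j x d| ≤ 2 * a * u * n := by
    intro d hd h1 h2
    have l1 := score_le_totalGain_add (θ := θ) (j := j) ((a * u) • d) (x := x) (τ := a * u)
      (fun y => by
        rw [linPred_smul, abs_mul, abs_of_pos hpos]; nlinarith [hd y]) hau
    have l2 := score_le_totalGain_add (θ := θ) (j := j) ((-(a * u)) • d) (x := x) (τ := a * u)
      (fun y => by
        rw [linPred_smul, abs_mul, abs_neg, abs_of_pos hpos]; nlinarith [hd y]) hau
    -- Both signs give a u |score| ≤ 2 a² u² n: half comes from the bound on the gain and half from
    -- the quadratic error. Division by a u finishes.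
    rw [score_smul] at l1 l2
    rw [abs_le]
    constructor <;> refine le_of_mul_le_mul_left ?_ hpos <;> nlinarith
  have e1 : ∀ s : ℝ, s • ((1, 0) : ℝ × (Fin p → ℝ)) = (s, 0) := fun s => by simp
  have e2 : ∀ (s : ℝ) (k : Fin p),
      s • ((0, Pi.single k 1) : ℝ × (Fin p → ℝ)) = (0, Pi.single k s) := fun s k => by
    rw [Prod.smul_mk, ← Pi.single_smul]; simp
  obtain ⟨p1, p2⟩ := h (a * u) (by simp)
  obtain ⟨m1, m2⟩ := h (-(a * u)) (by simp)
  refine ⟨key _ (fun y => by simp [linPred_intercept]) ?_ ?_, fun k hk =>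
    key _ (fun y => ?_) ?_ ?_⟩
  · rwa [e1]
  · rwa [e1]
  · rw [linPred_single, one_mul, abs_of_nonneg (bit_nonneg _ _)]; exact bit_le_one _ _
  · rw [e2]; exact p2 k hk
  · rw [e2]; exact m2 k hk

end Gain

/-! ### The log-likelihood near and far from the true parameter -/

section Localization

variable {n p : ℕ} {θ : ℝ × (Fin p → ℝ)} {j : Fin p}

/-- On the nodes in `U`, the pattern without ones and each pattern with a single one have
frequency at least `ν` in the sample `x`. -/
def PatternFreq (x : Fin n → Fin p → Fin 2) (U : Finset (Fin p)) (ν : ℝ) : Prop :=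
  ν * n ≤ (Finset.univ.filter fun i => ∀ l ∈ U, x i l = 0).card ∧
    ∀ k ∈ U, ν * n ≤ (Finset.univ.filter fun i => ∀ l ∈ U,
      x i l = (Pi.single k 1 : Fin p → Fin 2) l).card

theorem bit_congr {x y : Fin p → Fin 2} {k : Fin p} (h : x k = y k) : bit x k = bit y k := by
  unfold bit; rw [h]

theorem linPred_congr {U : Finset (Fin p)} {d : ℝ × (Fin p → ℝ)} (hd : ∀ k ∉ U, d.2 k = 0)
    {x y : Fin p → Fin 2} (h : ∀ k ∈ U, x k = y k) : linPred d x = linPred d y := by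
  unfold linPred
  congr 1
  refine Finset.sum_congr rfl fun k _ => ?_
  by_cases hk : k ∈ U
  · rw [bit_congr (h k hk)]
  · simp [hd k hk]

theorem mul_sq_le_sum_sq_linPred {x : Fin n → Fin p → Fin 2} {U : Finset (Fin p)} {ν : ℝ}
    {d : ℝ × (Fin p → ℝ)} (hd : ∀ k ∉ U, d.2 k = 0) (y : Fin p → Fin 2)
    (h : ν * n ≤ (Finset.univ.filter fun i => ∀ l ∈ U, x i l = y l).card) :
    ν * n * linPred d y ^ 2 ≤ ∑ i, linPred d (x i) ^ 2 := by
  calc ν * n * linPred d y ^ 2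
      ≤ (Finset.univ.filter fun i => ∀ l ∈ U, x i l = y l).card * linPred d y ^ 2 := by gcongr
    _ = ∑ i ∈ Finset.univ.filter fun i => ∀ l ∈ U, x i l = y l, linPred d (x i) ^ 2 := by
      rw [Finset.sum_congr rfl fun i hi => by
        rw [linPred_congr hd (Finset.mem_filter.1 hi).2], Finset.sum_const, nsmul_eq_mul]
    _ ≤ _ := Finset.sum_le_sum_of_subset_of_nonneg (Finset.filter_subset _ _)
        fun i _ _ => sq_nonneg _

/-- The zero pattern sees the intercept and a single one sees intercept plus slope, so these
patterns determine `d`. The 4 comes from b² ≤ 2 (a + b)² + 2 a². -/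
theorem PatternFreq.le_sum_sq {x : Fin n → Fin p → Fin 2} {U : Finset (Fin p)} {ν : ℝ}
    (h : PatternFreq x U ν) (hν : 0 ≤ ν) {d : ℝ × (Fin p → ℝ)} (hd : ∀ k ∉ U, d.2 k = 0) :
    ν * n / 4 * ‖d‖ ^ 2 ≤ ∑ i, linPred d (x i) ^ 2 := by
  rcases eq_or_ne ‖d‖ 0 with h0n | h0n
  · rw [h0n]; simpa using Finset.sum_nonneg fun i _ => sq_nonneg (linPred d (x i))
  set Q := ∑ i, linPred d (x i) ^ 2 with hQdef
  have hQ : 0 ≤ Q := Finset.sum_nonneg fun i _ => sq_nonneg _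
  have hw : 0 ≤ ν * n := by positivity
  rcases hw.eq_or_lt with hw | hw
  · rw [← hw]; simpa using hQ
  have b0 : linPred d 0 = d.1 := by simp [linPred, bit]
  have h0 : ν * n * d.1 ^ 2 ≤ Q := by
    rw [← b0]; exact mul_sq_le_sum_sq_linPred hd 0 h.1
  have hk : ∀ k ∈ U, ν * n * (d.1 + d.2 k) ^ 2 ≤ Q := by
    intro k hk
    have b1 : linPred d (Pi.single k 1) = d.1 + d.2 k := by
      unfold linPred
      congr 1
      rw [Finset.sum_eq_single k]
      · simp [bit]
      · intro l _ hl; simp [bit, hl]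
      · simp
    rw [← b1]; exact mul_sq_le_sum_sq_linPred hd _ (h.2 k hk)
  clear_value Q
  have hs : ‖d‖ ≤ Real.sqrt (4 * Q / (ν * n)) := by
    rw [Prod.norm_def, max_le_iff, pi_norm_le_iff_of_nonneg (Real.sqrt_nonneg _)]
    refine ⟨Real.abs_le_sqrt ?_, fun k => Real.abs_le_sqrt ?_⟩
    · rw [le_div_iff₀ hw]; linarith
    · rw [le_div_iff₀ hw]
      by_cases hkU : k ∈ U
      · nlinarith [hk k hkU, mul_nonneg hw.le (sq_nonneg (2 * d.1 + d.2 k))]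
      · rw [hd k hkU]; simpa using hQ
  have hs2 : ‖d‖ ^ 2 ≤ 4 * Q / (ν * n) :=
    (Real.le_sqrt' (lt_of_le_of_ne (norm_nonneg d) h0n.symm)).1 hs
  rw [le_div_iff₀ hw] at hs2
  linarith

/-- Away from `θ`, the log-likelihood is much smaller than at `θ`. -/
theorem totalGain_le_of_far {x : Fin n → Fin p → Fin 2} {U : Finset (Fin p)} (hj : j ∉ U) {m : ℕ}
    (hU : U.card ≤ m) {ν M a u W C : ℝ} (hν : 0 ≤ ν) (hfreq : PatternFreq x U ν)
    (hM : ∀ x, |linPred θ x| ≤ M) (hscore : ScoreBound θ j x (2 * a * u * n)) (hu : 0 < u)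
    (hW : 0 < W) (hWu : (m + 1) * (W * u) ≤ 1) (hC : 0 ≤ C)
    (hWC : (m + 1) * (W * (2 * a)) - Real.exp (-M) / 32 * (ν / 4 * W ^ 2) ≤ -C)
    {d : ℝ × (Fin p → ℝ)} (hd : ∀ k ∉ U, d.2 k = 0) (hfar : W * u ≤ ‖d‖) :
    totalGain θ j d x ≤ -C * (u ^ 2 * n) := by
  have hn : (0 : ℝ) ≤ n := n.cast_nonneg
  have hWu0 : 0 < W * u := mul_pos hW hu
  have hd0 : 0 < ‖d‖ := hWu0.trans_le hfar
  -- Shrink `d` to the sphere of radius W u, where the quadratic expansion is valid; concavity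
  -- carries the bound back out to `d`.
  set b := W * u / ‖d‖ with hb
  have hb0 : 0 ≤ b := by positivity
  have hb1 : b ≤ 1 := by rw [hb, div_le_one hd0]; exact hfar
  have hbn : ‖b • d‖ = W * u := by
    rw [norm_smul, Real.norm_of_nonneg hb0, hb, div_mul_cancel₀ _ hd0.ne']
  have hbd : ∀ k ∉ U, (b • d).2 k = 0 := fun k hk => by simp [hd k hk]
  have h1 : totalGain θ j (b • d) x ≤ -C * (u ^ 2 * n) := by
    have l0 := totalGain_le (j := j) (b • d) (x := x) hM fun y =>
      (abs_linPred_le hU hbd y).trans (by rw [hbn]; exact hWu)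
    have l1 := (le_abs_self _).trans (hscore.abs_score_le hj hU hbd)
    have l2 := hfreq.le_sum_sq hν hbd
    rw [hbn] at l1 l2
    have l3 := mul_le_mul_of_nonneg_left l2 (by positivity : 0 ≤ Real.exp (-M) / 32)
    have l4 := mul_le_mul_of_nonneg_right hWC (by positivity : 0 ≤ u ^ 2 * n)
    nlinarith
  by_contra hcon
  push Not at hcon
  have h2 := mul_totalGain_le (θ := θ) (j := j) d x hb0 hb1
  have h3 : 0 ≤ C * (u ^ 2 * n) := by positivity
  rcases hb0.eq_or_lt with h | h
  · exact absurd h.symm (div_pos hWu0 hd0).ne'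
  · nlinarith [mul_lt_mul_of_pos_left hcon h]

/-- Near `θ`, the log-likelihood varies little. -/
theorem totalGain_sub_le_of_near {x : Fin n → Fin p → Fin 2} {U : Finset (Fin p)} (hj : j ∉ U)
    {m : ℕ} (hU : U.card ≤ m) {a u W ε : ℝ} (hscore : ScoreBound θ j x (2 * a * u * n))
    (hu : 0 < u) (ha : 0 ≤ a)
    {d e : ℝ × (Fin p → ℝ)} (hd : ∀ k ∉ U, d.2 k = 0) (he : ∀ k ∉ U, e.2 k = 0)
    (hnear : ‖e‖ ≤ W * u) (hde : ‖d - e‖ ≤ ε * u) :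
    totalGain θ j d x - totalGain θ j e x
      ≤ ((m + 1) * (2 * a) + (m + 1) ^ 2 * W) * ε * (u ^ 2 * n) := by
  have hn : (0 : ℝ) ≤ n := n.cast_nonneg
  have hsub : ∀ k ∉ U, (d - e).2 k = 0 := fun k hk => by simp [hd k hk, he k hk]
  have h1 := totalGain_sub_le (θ := θ) (j := j) d e x (a := (m + 1) * (W * u))
    (b := (m + 1) * (ε * u)) (fun y => (abs_linPred_le hU he y).trans (by gcongr))
    (fun y => (abs_linPred_le hU hsub y).trans (by gcongr))
  have h2 := (le_abs_self _).trans (hscore.abs_score_le hj hU hsub)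
  have h3 : ((m : ℝ) + 1) * (‖d - e‖ * (2 * a * u * n)) ≤ (m + 1) * (ε * u * (2 * a * u * n)) := by
    gcongr
  nlinarith

end Localization

/-! ### Conditional distributions and pattern probabilities in the Ising model -/

section Ising

variable {p : ℕ} {ζ : Fin p → ℝ} {Θ : Matrix (Fin p) (Fin p) ℝ}

/-- Intercept and slopes of the conditional log-odds of node `j` in the Ising model. -/
def nodeParam (ζ : Fin p → ℝ) (Θ : Matrix (Fin p) (Fin p) ℝ) (j : Fin p) : ℝ × (Fin p → ℝ) :=
  (ζ j, fun k => Θ j k)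

/-- Change the coordinate `j` of a binary vector. -/
def flipAt (j : Fin p) : Equiv.Perm (Fin p → Fin 2) :=
  let f := fun x : Fin p → Fin 2 => Function.update x j (x j).rev
  have hf : Function.Involutive f := fun x => by simp [f]
  ⟨f, f, hf.leftInverse, hf.rightInverse⟩

theorem flipAt_apply (j : Fin p) (x : Fin p → Fin 2) :
    flipAt j x = Function.update x j (x j).rev := rfl

theorem flipAt_same (j : Fin p) (x : Fin p → Fin 2) : flipAt j x j = (x j).rev := by
  simp [flipAt_apply]

theorem flipAt_of_ne {j k : Fin p} (h : k ≠ j) (x : Fin p → Fin 2) : flipAt j x k = x k := by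
  simp [flipAt_apply, h]

theorem flipAt_flipAt (j : Fin p) (x : Fin p → Fin 2) : flipAt j (flipAt j x) = x := by
  simp [flipAt_apply]

/-- Comparing sums on pairs that differ only at `j` amounts to conditioning on all other
coordinates, without introducing conditional expectations. -/
theorem sum_le_sum_of_flipAt (j : Fin p) {f g : (Fin p → Fin 2) → ℝ}
    (h : ∀ x, x j = 0 → f x + f (flipAt j x) ≤ g x + g (flipAt j x)) : ∑ x, f x ≤ ∑ x, g x := by
  have h' : ∀ x, f x + f (flipAt j x) ≤ g x + g (flipAt j x) := fun x => by
    rcases (show x j = 0 ∨ x j = 1 by generalize x j = a; fin_cases a <;> simp) with h0 | h1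
    · exact h x h0
    · have := h (flipAt j x) (by rw [flipAt_same, h1]; rfl)
      rw [flipAt_flipAt] at this
      linarith
  have hs := Finset.sum_le_sum fun x (_ : x ∈ Finset.univ) => h' x
  rw [Finset.sum_add_distrib, Finset.sum_add_distrib, Equiv.sum_comp (flipAt j) f,
    Equiv.sum_comp (flipAt j) g] at hs
  linarith

theorem linPred_flipAt {j : Fin p} {d : ℝ × (Fin p → ℝ)} (hd : d.2 j = 0) (x : Fin p → Fin 2) :
    linPred d (flipAt j x) = linPred d x := by
  refine linPred_congr (U := Finset.univ.erase j) (fun k hk => ?_) fun k hk =>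
    flipAt_of_ne (Finset.ne_of_mem_erase hk) x
  have : k = j := by simpa using hk
  rw [this, hd]

theorem quadratic_exponent_flipAt {A : Fin p → Fin p → ℝ} (hsymm : ∀ j k, A k j = A j k)
    (hdiag : ∀ j, A j j = 0) {j : Fin p} {x : Fin p → Fin 2} (hx : x j = 0) :
    ∑ k, ζ k * bit (flipAt j x) k + (1 / 2) * ∑ a, ∑ b,
        (if a ≠ b then A a b * bit (flipAt j x) a * bit (flipAt j x) b else 0)
      = ∑ k, ζ k * bit x k + (1 / 2) * ∑ a, ∑ b,
        (if a ≠ b then A a b * bit x a * bit x b else 0) + (ζ j + ∑ k, A j k * bit x k) := by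
  have hb : ∀ k, bit (flipAt j x) k = bit x k + if k = j then 1 else 0 := fun k => by
    by_cases hk : k = j
    · subst hk
      simp [bit, flipAt_same, hx]
    · simp [hk, bit, flipAt_of_ne hk]
  have hite : ∀ (y : Fin p → Fin 2) (a b : Fin p),
      (if a ≠ b then A a b * bit y a * bit y b else 0) = A a b * bit y a * bit y b := by
    intro y a b
    by_cases h : a = b
    · subst h; simp [hdiag]
    · simp [h]
  simp only [hite]
  simp only [hb, mul_add, add_mul, Finset.sum_add_distrib, mul_ite, ite_mul, mul_one,
    mul_zero, zero_mul, Finset.sum_ite_eq', Finset.mem_univ, if_true]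
  have h1 : ∀ a : Fin p, ∑ b, (if a = j then A a b * bit x b else 0)
      = if a = j then ∑ b, A a b * bit x b else 0 := fun a => by
    split_ifs <;> simp
  have h2 : ∑ a, A a j * bit x a = ∑ a, A j a * bit x a :=
    Finset.sum_congr rfl fun a _ => by rw [hsymm]
  simp only [h1, Finset.sum_ite_eq', Finset.mem_univ, if_true, hdiag, h2]
  ring

theorem isingWeight_flipAt (hsymm : Θ.IsSymm) (hdiag : ∀ j, Θ j j = 0) {j : Fin p}
    {x : Fin p → Fin 2} (hx : x j = 0) :
    isingWeight ζ Θ (flipAt j x) = isingWeight ζ Θ x * Real.exp (linPred (nodeParam ζ Θ j) x) := by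
  have h := quadratic_exponent_flipAt (ζ := ζ) (A := fun a b => Θ a b)
    (fun a b => hsymm.apply a b) hdiag hx
  exact (congrArg Real.exp h).trans (Real.exp_add _ _)

theorem isingWeight_pos (x : Fin p → Fin 2) : 0 < isingWeight ζ Θ x := Real.exp_pos _

theorem sum_isingWeight_pos : 0 < ∑ y : Fin p → Fin 2, isingWeight ζ Θ y :=
  Finset.sum_pos (fun y _ => isingWeight_pos y) ⟨fun _ => 0, Finset.mem_univ _⟩

theorem isingProb_pos (x : Fin p → Fin 2) : 0 < isingProb ζ Θ x :=
  div_pos (isingWeight_pos x) sum_isingWeight_pos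

theorem sum_isingProb : ∑ x, isingProb ζ Θ x = 1 := by
  unfold isingProb
  rw [← Finset.sum_div, div_self sum_isingWeight_pos.ne']

/-- The normalizing constant cancels: this is the logistic form of the conditional law of node `j`.
-/
theorem isingProb_flipAt (hsymm : Θ.IsSymm) (hdiag : ∀ j, Θ j j = 0) {j : Fin p}
    {x : Fin p → Fin 2} (hx : x j = 0) :
    isingProb ζ Θ (flipAt j x) = isingProb ζ Θ x * Real.exp (linPred (nodeParam ζ Θ j) x) := by
  unfold isingProb
  rw [isingWeight_flipAt hsymm hdiag hx]
  ring

theorem exp_softplus (t : ℝ) : Real.exp (softplus t) = 1 + Real.exp t :=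
  Real.exp_log (by positivity)

/-- The likelihood ratio has mean at most one. -/
theorem sum_isingProb_mul_exp_gain_le (hsymm : Θ.IsSymm) (hdiag : ∀ j, Θ j j = 0) {j : Fin p}
    {d : ℝ × (Fin p → ℝ)} (hd : d.2 j = 0) :
    ∑ x, isingProb ζ Θ x * Real.exp (gain (nodeParam ζ Θ j) j d x) ≤ 1 := by
  rw [← sum_isingProb (ζ := ζ) (Θ := Θ)]
  -- On each pair the identity is exact: 1 + exp (t + r), divided by exp of the softplus increment,
  -- is 1 + exp t.
  refine sum_le_sum_of_flipAt j fun x hx => le_of_eq ?_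
  have b0 : bit x j = 0 := by simp [bit, hx]
  have b1 : bit (flipAt j x) j = 1 := by simp [bit, flipAt_same, hx]
  rw [isingProb_flipAt hsymm hdiag hx]
  unfold gain
  rw [linPred_flipAt hd, linPred_flipAt (hdiag j), b0, b1]
  set t := linPred (nodeParam ζ Θ j) x
  set r := linPred d x
  have p1 := Real.exp_pos t
  have p2 := Real.exp_pos (t + r)
  have e : Real.exp (t + r) = Real.exp t * Real.exp r := Real.exp_add t r
  simp only [Real.exp_sub, exp_softplus, zero_mul, one_mul, Real.exp_zero]
  rw [e] at p2 ⊢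
  field_simp

/-- The probability that the coordinates in `U` agree with `y`. -/
noncomputable def patternProb (ζ : Fin p → ℝ) (Θ : Matrix (Fin p) (Fin p) ℝ) (U : Finset (Fin p))
    (y : Fin p → Fin 2) : ℝ :=
  ∑ x, if ∀ l ∈ U, x l = y l then isingProb ζ Θ x else 0

/-- Given the other nodes, either value of node `j` has probability at least 1 / (1 + exp M). -/
theorem isingProb_add_flipAt_le (hsymm : Θ.IsSymm) (hdiag : ∀ j, Θ j j = 0) {M : ℝ}
    (hM : ∀ j x, |linPred (nodeParam ζ Θ j) x| ≤ M) {j : Fin p} {x : Fin p → Fin 2} (hx : x j = 0) :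
    isingProb ζ Θ x + isingProb ζ Θ (flipAt j x) ≤ (1 + Real.exp M) * isingProb ζ Θ x ∧
    isingProb ζ Θ x + isingProb ζ Θ (flipAt j x)
      ≤ (1 + Real.exp M) * isingProb ζ Θ (flipAt j x) := by
  have h := abs_le.1 (hM j x)
  have hp := isingProb_pos (ζ := ζ) (Θ := Θ) x
  rw [isingProb_flipAt hsymm hdiag hx]
  set t := linPred (nodeParam ζ Θ j) x
  have h1 : Real.exp t ≤ Real.exp M := Real.exp_le_exp.2 h.2
  have h2 : 1 ≤ Real.exp M * Real.exp t := by
    rw [← Real.exp_add]; exact Real.one_le_exp (by linarith)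
  constructor <;> nlinarith

theorem patternProb_le_insert (hsymm : Θ.IsSymm) (hdiag : ∀ j, Θ j j = 0) {M : ℝ}
    (hM : ∀ j x, |linPred (nodeParam ζ Θ j) x| ≤ M) {U : Finset (Fin p)} {l : Fin p} (hl : l ∉ U)
    (y : Fin p → Fin 2) :
    patternProb ζ Θ U y ≤ (1 + Real.exp M) * patternProb ζ Θ (insert l U) y := by
  unfold patternProb
  rw [Finset.mul_sum]
  refine sum_le_sum_of_flipAt l fun x hx => ?_
  obtain ⟨h0, h1⟩ := isingProb_add_flipAt_le hsymm hdiag hM hx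
  have hU : (∀ k ∈ U, flipAt l x k = y k) ↔ ∀ k ∈ U, x k = y k :=
    forall₂_congr fun k hk => by rw [flipAt_of_ne fun h : k = l => hl (h ▸ hk)]
  have hf : flipAt l x l = 1 := by rw [flipAt_same, hx]; rfl
  simp only [Finset.forall_mem_insert, hU, hx, hf]
  by_cases hm : ∀ k ∈ U, x k = y k
  · rcases (show y l = 0 ∨ y l = 1 by generalize y l = a; fin_cases a <;> simp) with hy | hy
    · rw [if_pos hm, if_pos hm, if_pos ⟨hy.symm, hm⟩, if_neg (by simp [hy])]; linarith
    · rw [if_pos hm, if_pos hm, if_neg (by simp [hy]), if_pos ⟨hy.symm, hm⟩]; linarith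
  · simp [hm]

/-- Fixing one more node costs at most one factor 1 + exp M, so the bound depends on the size of `U`
but not on `p`. -/
theorem le_patternProb (hsymm : Θ.IsSymm) (hdiag : ∀ j, Θ j j = 0) {M : ℝ}
    (hM : ∀ j x, |linPred (nodeParam ζ Θ j) x| ≤ M) (U : Finset (Fin p)) (y : Fin p → Fin 2) :
    ((1 + Real.exp M)⁻¹) ^ U.card ≤ patternProb ζ Θ U y := by
  induction U using Finset.induction_on with
  | empty => simp [patternProb, sum_isingProb]
  | insert l U hl ih =>
    have h := patternProb_le_insert hsymm hdiag hM hl y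
    have hpos : 0 < 1 + Real.exp M := by positivity
    rw [Finset.card_insert_of_notMem hl, pow_succ, ← div_eq_mul_inv, div_le_iff₀ hpos]
    linarith

/-- The probability generating function of a pattern frequency. -/
theorem sum_isingProb_mul_exp_pattern_le {U : Finset (Fin p)} {y : Fin p → Fin 2} {π : ℝ}
    (h : π ≤ patternProb ζ Θ U y) :
    ∑ x, isingProb ζ Θ x * Real.exp (-(if ∀ l ∈ U, x l = y l then (1 : ℝ) else 0))
      ≤ Real.exp (-(π / 2)) := by
  have h1 : ∑ x, isingProb ζ Θ x * Real.exp (-(if ∀ l ∈ U, x l = y l then (1 : ℝ) else 0))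
      = 1 - (1 - Real.exp (-1)) * patternProb ζ Θ U y := by
    rw [patternProb, Finset.mul_sum]
    nth_rewrite 2 [← sum_isingProb (ζ := ζ) (Θ := Θ)]
    rw [← Finset.sum_sub_distrib]
    refine Finset.sum_congr rfl fun x _ => ?_
    split_ifs
    · ring
    · simp
  have h2 : Real.exp (-1) ≤ 1 / 2 := by
    have := Real.add_one_le_exp (1 : ℝ)
    rw [Real.exp_neg, inv_eq_one_div, div_le_div_iff₀ (Real.exp_pos _) (by norm_num)]
    linarith
  have h3 : 0 ≤ patternProb ζ Θ U y := Finset.sum_nonneg fun x _ => by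
    split_ifs
    · exact (isingProb_pos x).le
    · rfl
  have h4 := Real.add_one_le_exp (-(π / 2))
  rw [h1]
  nlinarith

end Ising

/-! ### Exponential tail bound for i.i.d. samples -/

section Chernoff

variable {Ω : Type*} [MeasurableSpace Ω] {μ : Measure Ω} [IsProbabilityMeasure μ]

/-- Chernoff's bound for an i.i.d. sample of a finitely supported distribution. -/
theorem measureReal_sum_ge_le {n : ℕ} {E : Type*} [Fintype E] [MeasurableSpace E]
    [MeasurableSingletonClass E] {X : Fin n → Ω → E} (hmeas : ∀ i, Measurable (X i))
    (hindep : iIndepFun X μ) {w : E → ℝ} (hlaw : ∀ i x, μ.real {ω | X i ω = x} = w x)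
    (h : E → ℝ) (s : ℝ) :
    μ.real {ω | s ≤ ∑ i, h (X i ω)} ≤ Real.exp (-s) * (∑ x, w x * Real.exp (h x)) ^ n := by
  have hh : Measurable h := measurable_of_countable h
  have hind : iIndepFun (fun i ω => h (X i ω)) μ := hindep.comp (fun _ => h) fun _ => hh
  have hmgf : mgf (∑ i, fun ω => h (X i ω)) μ 1 = (∑ x, w x * Real.exp (h x)) ^ n := by
    rw [hind.mgf_sum (fun i => hh.comp (hmeas i)), Finset.prod_congr rfl fun i _ => ?_,
      Finset.prod_const, Finset.card_univ, Fintype.card_fin]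
    have : IsProbabilityMeasure (μ.map (X i)) :=
      Measure.isProbabilityMeasure_map (hmeas i).aemeasurable
    have e1 : mgf (fun ω => h (X i ω)) μ 1 = ∫ x, Real.exp (h x) ∂(μ.map (X i)) := by
      rw [integral_map (hmeas i).aemeasurable (measurable_of_countable _).aestronglyMeasurable]
      simp [mgf]
    rw [e1, integral_fintype Integrable.of_finite]
    refine Finset.sum_congr rfl fun x _ => ?_
    rw [← hlaw i x, map_measureReal_apply (hmeas i) (measurableSet_singleton x), smul_eq_mul]
    rfl
  have hint : Integrable (fun ω => Real.exp (1 * (∑ i, fun ω => h (X i ω)) ω)) μ := by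
    have hE : ∀ i, Integrable (fun ω => Real.exp (1 * h (X i ω))) μ := fun i => by
      have : Integrable (fun x => Real.exp (1 * h x)) (μ.map (X i)) := by
        have : IsProbabilityMeasure (μ.map (X i)) :=
          Measure.isProbabilityMeasure_map (hmeas i).aemeasurable
        exact Integrable.of_finite
      exact this.comp_measurable (hmeas i)
    exact hind.integrable_exp_mul_sum (fun i => hh.comp (hmeas i)) fun i _ => hE i
  have := measure_ge_le_exp_mul_mgf (μ := μ) (X := ∑ i, fun ω => h (X i ω)) s zero_le_one hint
  rw [hmgf] at this
  simpa [Finset.sum_apply] using this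

end Chernoff

/-! ### Finite nets of sparse parameters -/

section Net

variable {p : ℕ}

/-- The multiples of `ρ / N` in `[-ρ, ρ]`. -/
noncomputable def grid (ρ : ℝ) (N : ℕ) : Finset ℝ :=
  (Finset.Icc (-(N : ℤ)) N).image fun i : ℤ => (i : ℝ) * (ρ / N)

theorem card_grid_le (ρ : ℝ) (N : ℕ) : (grid ρ N).card ≤ 2 * N + 1 := by
  refine Finset.card_image_le.trans ?_
  rw [Int.card_Icc]
  omega

theorem exists_mem_grid {ρ : ℝ} {N : ℕ} (hN : 0 < N) {t : ℝ} (ht : |t| ≤ ρ) :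
    ∃ s ∈ grid ρ N, |s| ≤ ρ ∧ |t - s| ≤ ρ / N := by
  have hN' : (0 : ℝ) < N := by exact_mod_cast hN
  have hρ : 0 ≤ ρ := (abs_nonneg t).trans ht
  rcases hρ.eq_or_lt with h0 | h0
  · refine ⟨0, Finset.mem_image.2 ⟨0, by simp, by simp⟩, by simpa using hρ, ?_⟩
    rw [← h0] at ht ⊢
    simpa using ht
  have hst : 0 < ρ / N := by positivity
  have hle := abs_le.1 ht
  set i := ⌊t / (ρ / N)⌋ with hi
  have e : (N : ℝ) * (ρ / N) = ρ := by field_simp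
  have f1 : (i : ℝ) * (ρ / N) ≤ t := by
    rw [← le_div_iff₀ hst]; exact Int.floor_le _
  have f2 : t < ((i : ℝ) + 1) * (ρ / N) := by
    rw [← div_lt_iff₀ hst]; exact Int.lt_floor_add_one _
  have i1 : -(N : ℤ) ≤ i := by
    rw [hi, Int.le_floor, le_div_iff₀ hst]
    push_cast
    linarith
  have i2 : i ≤ N := by
    have : (i : ℝ) ≤ N := le_of_mul_le_mul_right (by linarith) hst
    exact_mod_cast this
  have i1' : -(N : ℝ) ≤ i := by exact_mod_cast i1
  refine ⟨i * (ρ / N), Finset.mem_image.2 ⟨i, Finset.mem_Icc.2 ⟨i1, i2⟩, rfl⟩, ?_, ?_⟩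
  · rw [abs_le]
    exact ⟨by nlinarith, by linarith⟩
  · rw [abs_le]
    exact ⟨by linarith, by linarith⟩

/-- A finite net in the cube of radius `ρ` of parameters supported on `T`. -/
noncomputable def cubeNet (T : Finset (Fin p)) (ρ : ℝ) (N : ℕ) : Finset (ℝ × (Fin p → ℝ)) :=
  grid ρ N ×ˢ Fintype.piFinset fun k => if k ∈ T then grid ρ N else {0}

/-- Coordinates outside `T` are frozen at zero, which keeps `p` out of the bound. -/
theorem card_cubeNet_le (T : Finset (Fin p)) (ρ : ℝ) (N : ℕ) :
    (cubeNet T ρ N).card ≤ (2 * N + 1) ^ (T.card + 1) := by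
  unfold cubeNet
  rw [Finset.card_product, Fintype.card_piFinset, pow_succ, mul_comm]
  refine Nat.mul_le_mul ?_ (card_grid_le ρ N)
  have h : ∀ k : Fin p, (if k ∈ T then grid ρ N else {0}).card
      = if k ∈ T then (grid ρ N).card else 1 := fun k => by split_ifs <;> simp
  simp only [h, Finset.prod_ite_mem, Finset.univ_inter, Finset.prod_const]
  exact Nat.pow_le_pow_left (card_grid_le ρ N) _

theorem snd_eq_zero_of_mem_cubeNet {T : Finset (Fin p)} {ρ : ℝ} {N : ℕ} {e : ℝ × (Fin p → ℝ)}
    (he : e ∈ cubeNet T ρ N) {k : Fin p} (hk : k ∉ T) : e.2 k = 0 := by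
  have := Fintype.mem_piFinset.1 (Finset.mem_product.1 he).2 k
  simpa [hk] using this

theorem exists_mem_cubeNet {T : Finset (Fin p)} {ρ : ℝ} {N : ℕ} (hN : 0 < N)
    {d : ℝ × (Fin p → ℝ)} (hd : ∀ k ∉ T, d.2 k = 0) (hdρ : ‖d‖ ≤ ρ) :
    ∃ e ∈ cubeNet T ρ N, ‖e‖ ≤ ρ ∧ ‖d - e‖ ≤ ρ / N := by
  have hρ : 0 ≤ ρ := (norm_nonneg d).trans hdρ
  have hρN : 0 ≤ ρ / N := by positivity
  obtain ⟨s, hs, hs1, hs2⟩ := exists_mem_grid hN ((norm_fst_le d).trans hdρ)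
  have hk : ∀ k, ∃ r ∈ (if k ∈ T then grid ρ N else {0} : Finset ℝ), |r| ≤ ρ ∧
      |d.2 k - r| ≤ ρ / N := by
    intro k
    by_cases h : k ∈ T
    · simpa only [h, if_true] using exists_mem_grid hN ((abs_snd_le_norm d k).trans hdρ)
    · exact ⟨0, by simp [h], by simpa using hρ, by simpa [hd k h] using hρN⟩
  choose r hr hr1 hr2 using hk
  refine ⟨(s, r), Finset.mem_product.2 ⟨hs, Fintype.mem_piFinset.2 hr⟩, ?_, ?_⟩
  · exact max_le hs1 ((pi_norm_le_iff_of_nonneg hρ).2 hr1)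
  · exact max_le hs2 ((pi_norm_le_iff_of_nonneg hρN).2 hr2)

end Net

/-! ### Deterministic criterion for correct selection -/

section Selection

variable {n p : ℕ} {ζ : Fin p → ℝ} {Θ : Matrix (Fin p) (Fin p) ℝ}

theorem nodeParam_snd (j k : Fin p) : (nodeParam ζ Θ j).2 k = Θ j k := rfl

theorem mem_neighborhood {j k : Fin p} : k ∈ neighborhood Θ j ↔ k ≠ j ∧ Θ j k ≠ 0 := by
  simp [neighborhood]

theorem self_notMem_neighborhood (j : Fin p) : j ∉ neighborhood Θ j := by
  simp [mem_neighborhood]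

theorem eq_zero_of_notMem_neighborhood (hdiag : ∀ j, Θ j j = 0) {j k : Fin p}
    (hk : k ∉ neighborhood Θ j) : Θ j k = 0 := by
  by_contra h
  refine hk (mem_neighborhood.2 ⟨?_, h⟩)
  rintro rfl
  exact h (hdiag k)

/-- The parameter of a logistic regression on the nodes in `S`, extended by zero. -/
noncomputable def extendParam (S : Finset (Fin p)) (b₀ : ℝ) (b : Fin p → ℝ) : ℝ × (Fin p → ℝ) :=
  (b₀, fun k => if k ∈ S then b k else 0)

theorem linPred_extendParam (S : Finset (Fin p)) (b₀ : ℝ) (b : Fin p → ℝ) (x : Fin p → Fin 2) :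
    linPred (extendParam S b₀ b) x = b₀ + ∑ k ∈ S, b k * bit x k := by
  simp [linPred, extendParam, ite_mul]

theorem extendParam_neighborhood (hdiag : ∀ j, Θ j j = 0) (j : Fin p) :
    extendParam (neighborhood Θ j) (ζ j) (fun k => Θ j k) = nodeParam ζ Θ j := by
  unfold extendParam nodeParam
  congr 1
  funext k
  split_ifs with h
  · rfl
  · exact (eq_zero_of_notMem_neighborhood hdiag h).symm

theorem logLik_eq_add_totalGain (hdiag : ∀ j, Θ j j = 0) (x : Fin n → Fin p → Fin 2) (j : Fin p)
    (S : Finset (Fin p)) (b₀ : ℝ) (b : Fin p → ℝ) :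
    logLik x j S b₀ b = logLik x j (neighborhood Θ j) (ζ j) (fun k => Θ j k)
      + totalGain (nodeParam ζ Θ j) j (extendParam S b₀ b - nodeParam ζ Θ j) x := by
  unfold logLik totalGain gain softplus
  simp only [← linPred_extendParam, extendParam_neighborhood hdiag, linPred_sub, add_sub_cancel]
  rw [← Finset.sum_add_distrib]
  exact Finset.sum_congr rfl fun i _ => by ring

/-- The maximum over the true neighborhood is only bounded below by its value at θ, so the maximum
likelihood estimator there need not be studied. -/
theorem maxLogLik_le_add (hdiag : ∀ j, Θ j j = 0) {x : Fin n → Fin p → Fin 2} {j : Fin p}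
    {S : Finset (Fin p)} {B : ℝ} (h : ∀ (b₀ : ℝ) (b : Fin p → ℝ),
      totalGain (nodeParam ζ Θ j) j (extendParam S b₀ b - nodeParam ζ Θ j) x ≤ B) :
    maxLogLik x j S ≤ maxLogLik x j (neighborhood Θ j) + B := by
  refine ciSup_le fun b => ?_
  have h1 : logLik x j (neighborhood Θ j) (ζ j) (fun k => Θ j k)
      ≤ maxLogLik x j (neighborhood Θ j) :=
    le_ciSup (f := fun b : ℝ × (Fin p → ℝ) => logLik x j (neighborhood Θ j) b.1 b.2)
      ⟨0, by rintro _ ⟨b, rfl⟩; exact logLik_nonpos x j _ _ _⟩ (ζ j, fun k => Θ j k)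
  have h2 := h b.1 b.2
  rw [logLik_eq_add_totalGain (ζ := ζ) hdiag]
  linarith

/-- A deterministic sufficient condition under which the true neighborhoods have the smallest
extended BIC, by a margin of more than `μ`. -/
theorem beatsBy_of_good (hdiag : ∀ j, Θ j j = 0) {q : ℕ} (hq : ∀ j, (neighborhood Θ j).card ≤ q)
    {M : ℝ} (hM : ∀ j x, |linPred (nodeParam ζ Θ j) x| ≤ M) {x : Fin n → Fin p → Fin 2}
    {a u W C ν η γ μ : ℝ} {N : ℕ} (hn : 0 < n) (hν : 0 ≤ ν) (hu : 0 < u) (ha : 0 ≤ a) (hW : 0 < W)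
    (hWu : ((2 * q : ℕ) + 1) * (W * u) ≤ 1) (hC : 0 ≤ C) (hη : 0 < η) (hN : 0 < N)
    (hWC : ((2 * q : ℕ) + 1) * (W * (2 * a)) - Real.exp (-M) / 32 * (ν / 4 * W ^ 2) ≤ -C)
    (hNη : ((q + 1) * (2 * a) + (q + 1) ^ 2 * W) * (W / N) ≤ η)
    (hθ : ∀ j, ∀ k ∈ neighborhood Θ j, W * u ≤ |Θ j k|)
    (hB : q * |Real.log n + 2 * γ * Real.log p| + |μ| < 2 * C * (u ^ 2 * n))
    (hscore : ∀ j, ScoreBound (nodeParam ζ Θ j) j x (2 * a * u * n))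
    (hfreq : ∀ U : Finset (Fin p), U.card ≤ 2 * q → PatternFreq x U ν)
    (hnet : ∀ j, ∀ R : Finset (Fin p), 1 ≤ R.card → R.card ≤ q → j ∉ R →
      (neighborhood Θ j ∪ R).card ≤ q → ∀ e ∈ cubeNet (neighborhood Θ j ∪ R) (W * u) N,
        totalGain (nodeParam ζ Θ j) j e x
          ≤ (R.card * (Real.log n + 2 * γ * Real.log p) - μ) / 2 - 2 * η * (u ^ 2 * n)) :
    BeatsBy γ q x (neighborhood Θ) μ := by
  intro j T hT hTS
  have hn' : (0 : ℝ) < n := by exact_mod_cast hn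
  have hun : 0 < u ^ 2 * n := by positivity
  set S := neighborhood Θ j with hS
  set K := Real.log n + 2 * γ * Real.log p with hK
  have hsupp : ∀ b₀ b, ∀ k ∉ S ∪ T, (extendParam T b₀ b - nodeParam ζ Θ j).2 k = 0 := by
    intro b₀ b k hk
    rw [Finset.mem_union, not_or] at hk
    simp [extendParam, hk.2, nodeParam_snd, eq_zero_of_notMem_neighborhood hdiag hk.1]
  have hjU : j ∉ S ∪ T := by
    rw [Finset.mem_union, not_or]; exact ⟨self_notMem_neighborhood j, hT.1⟩
  have hcard : (S ∪ T).card ≤ 2 * q :=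
    (Finset.card_union_le _ _).trans ((Nat.add_le_add (hq j) hT.2).trans (by omega))
  have far : ∀ b₀ b, W * u ≤ ‖extendParam T b₀ b - nodeParam ζ Θ j‖ →
      totalGain (nodeParam ζ Θ j) j (extendParam T b₀ b - nodeParam ζ Θ j) x
        ≤ -C * (u ^ 2 * n) := fun b₀ b h =>
    totalGain_le_of_far hjU hcard hν (hfreq _ hcard) (hM j) (hscore j) hu hW hWu hC hWC
      (hsupp b₀ b) h
  suffices h : ∃ B, (∀ b₀ b, totalGain (nodeParam ζ Θ j) j
      (extendParam T b₀ b - nodeParam ζ Θ j) x ≤ B) ∧ 2 * B < ((T.card : ℝ) - S.card) * K - μ by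
    obtain ⟨B, hB1, hB2⟩ := h
    have := maxLogLik_le_add hdiag hB1
    unfold ebic
    rw [← hS] at this
    rw [hK] at hB2
    nlinarith
  have hcardq : |(T.card : ℝ) - S.card| ≤ q := by
    have h1 : (T.card : ℝ) ≤ q := by exact_mod_cast hT.2
    have h2 : (S.card : ℝ) ≤ q := by exact_mod_cast hq j
    have h3 : (0 : ℝ) ≤ T.card := Nat.cast_nonneg _
    have h4 : (0 : ℝ) ≤ S.card := Nat.cast_nonneg _
    rw [abs_le]; constructor <;> linarith
  have hfarB : 2 * (-C * (u ^ 2 * n)) < ((T.card : ℝ) - S.card) * K - μ := by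
    have h1 : |((T.card : ℝ) - S.card) * K| ≤ q * |K| := by
      rw [abs_mul]; exact mul_le_mul_of_nonneg_right hcardq (abs_nonneg _)
    have h2 := (abs_le.1 h1).1
    have h3 := le_abs_self μ
    linarith
  -- If `S ⊆ T` the candidate only overfits, and near θ the net takes over; otherwise a true
  -- neighbor is missing and every parameter of the candidate is far from θ.
  by_cases hST : S ⊆ T
  · have hU : S ∪ T = T := Finset.union_eq_right.2 hST
    have hR : S ∪ T \ S = T := by rw [Finset.union_sdiff_self_eq_union, hU]
    have hRcard : ((T \ S).card : ℝ) = T.card - S.card := by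
      rw [Finset.card_sdiff_of_subset hST, Nat.cast_sub (Finset.card_le_card hST)]
    have hne : (T \ S).Nonempty := by
      rw [Finset.sdiff_nonempty]
      exact fun h => hTS (Finset.Subset.antisymm h hST)
    have net := hnet j (T \ S) hne.card_pos ((Finset.card_le_card Finset.sdiff_subset).trans hT.2)
      (fun h => hT.1 (Finset.mem_sdiff.1 h).1) (by rw [← hS, hR]; exact hT.2)
    rw [← hS, hR, hRcard] at net
    -- The net is bounded with 2η to spare; one η pays for moving to a net point, the other makes
    -- the final inequality strict.
    refine ⟨max (-C * (u ^ 2 * n))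
      ((((T.card : ℝ) - S.card) * K - μ) / 2 - η * (u ^ 2 * n)), fun b₀ b => ?_, ?_⟩
    · rw [hU] at hsupp hjU
      rcases le_total (W * u) ‖extendParam T b₀ b - nodeParam ζ Θ j‖ with h | h
      · exact le_max_of_le_left (far b₀ b h)
      · refine le_max_of_le_right ?_
        obtain ⟨e, he, he1, he2⟩ := exists_mem_cubeNet hN (hsupp b₀ b) h
        have h1 := totalGain_sub_le_of_near hjU hT.2 (hscore j) hu ha (ε := W / N)
          (hsupp b₀ b) (fun k hk => snd_eq_zero_of_mem_cubeNet he hk) he1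
          (he2.trans_eq (by ring))
        have h2 := net e he
        have h3 := mul_le_mul_of_nonneg_right hNη hun.le
        linarith
    · rw [mul_max_of_nonneg _ _ (by norm_num : (0 : ℝ) ≤ 2), max_lt_iff]
      exact ⟨hfarB, by linarith [mul_pos hη hun]⟩
  · obtain ⟨k, hkS, hkT⟩ := Finset.not_subset.1 hST
    refine ⟨-C * (u ^ 2 * n), fun b₀ b => far b₀ b ?_, hfarB⟩
    have h1 := abs_snd_le_norm (extendParam T b₀ b - nodeParam ζ Θ j) k
    have h2 : (extendParam T b₀ b - nodeParam ζ Θ j).2 k = -Θ j k := by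
      simp [extendParam, hkT, nodeParam_snd]
    rw [h2, abs_neg] at h1
    exact (hθ j k hkS).trans h1

end Selection

/-! ### Union bounds over scores, pattern frequencies and nets -/

section Probability

variable {Ω : Type*} [MeasurableSpace Ω] {P : Measure Ω}

theorem measureReal_biUnion_le_card_mul {ι : Type*} (s : Finset ι) (A : ι → Set Ω) {E : ℝ}
    (h : ∀ i ∈ s, P.real (A i) ≤ E) : P.real (⋃ i ∈ s, A i) ≤ s.card * E := by
  refine (measureReal_biUnion_finset_le s A).trans ?_
  rw [← nsmul_eq_mul]
  exact Finset.sum_le_card_nsmul s _ E h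

variable [IsProbabilityMeasure P] {n p : ℕ} {ζ : Fin p → ℝ} {Θ : Matrix (Fin p) (Fin p) ℝ}
  {X : Fin n → Ω → Fin p → Fin 2}

/-- Markov's inequality for a product of i.i.d. likelihood ratios, each of mean at most one. The
condition `d.2 j = 0` keeps node `j` from being its own predictor. -/
theorem measureReal_totalGain_gt_le (hsymm : Θ.IsSymm) (hdiag : ∀ j, Θ j j = 0)
    (hmeas : ∀ i, Measurable (X i)) (hindep : iIndepFun X P)
    (hlaw : ∀ i x, P.real {ω | X i ω = x} = isingProb ζ Θ x) {j : Fin p}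
    {d : ℝ × (Fin p → ℝ)} (hd : d.2 j = 0) (s : ℝ) :
    P.real {ω | s < totalGain (nodeParam ζ Θ j) j d fun i => X i ω} ≤ Real.exp (-s) := by
  have h1 := measureReal_sum_ge_le hmeas hindep hlaw (gain (nodeParam ζ Θ j) j d) s
  have h2 : (∑ x, isingProb ζ Θ x * Real.exp (gain (nodeParam ζ Θ j) j d x)) ^ n ≤ 1 :=
    pow_le_one₀ (Finset.sum_nonneg fun x _ => mul_nonneg (isingProb_pos x).le (Real.exp_pos _).le)
      (sum_isingProb_mul_exp_gain_le hsymm hdiag hd)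
  refine (measureReal_mono fun ω (hω : s < _) => hω.le).trans (h1.trans ?_)
  exact mul_le_of_le_one_right (Real.exp_pos _).le h2

/-- The pattern has probability at least 4ν, so Chernoff's bound is exp (ν n) exp (-2 ν n). -/
theorem measureReal_pattern_lt_le (hsymm : Θ.IsSymm) (hdiag : ∀ j, Θ j j = 0)
    (hmeas : ∀ i, Measurable (X i)) (hindep : iIndepFun X P)
    (hlaw : ∀ i x, P.real {ω | X i ω = x} = isingProb ζ Θ x) {M : ℝ}
    (hM : ∀ j x, |linPred (nodeParam ζ Θ j) x| ≤ M) {U : Finset (Fin p)} {m : ℕ}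
    (hU : U.card ≤ m) (y : Fin p → Fin 2) {ν : ℝ} (hν : ν = ((1 + Real.exp M)⁻¹) ^ m / 4) :
    P.real {ω | ((Finset.univ.filter fun i => ∀ l ∈ U, X i ω l = y l).card : ℝ) < ν * n}
      ≤ Real.exp (-(ν * n)) := by
  have hpat : 4 * ν ≤ patternProb ζ Θ U y := by
    refine le_trans ?_ (le_patternProb hsymm hdiag hM U y)
    rw [hν, mul_div_cancel₀ _ (by norm_num : (4 : ℝ) ≠ 0)]
    exact pow_le_pow_of_le_one (by positivity)
      (inv_le_one_of_one_le₀ (by linarith [Real.exp_pos M])) hU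
  have h1 := measureReal_sum_ge_le hmeas hindep hlaw
    (fun x => -(if ∀ l ∈ U, x l = y l then (1 : ℝ) else 0)) (-(ν * n))
  have h2 : (∑ x, isingProb ζ Θ x * Real.exp (-(if ∀ l ∈ U, x l = y l then (1 : ℝ) else 0))) ^ n
      ≤ Real.exp (-(4 * ν / 2)) ^ n :=
    pow_le_pow_left₀ (Finset.sum_nonneg fun x _ =>
      mul_nonneg (isingProb_pos x).le (Real.exp_pos _).le) (sum_isingProb_mul_exp_pattern_le hpat) n
  refine (measureReal_mono fun ω hω => ?_).trans (h1.trans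
    ((mul_le_mul_of_nonneg_left h2 (Real.exp_pos _).le).trans_eq ?_))
  · simp only [Set.mem_ofPred_eq] at hω ⊢
    rw [Finset.sum_neg_distrib, Finset.sum_boole]
    linarith
  · rw [← Real.exp_nat_mul, ← Real.exp_add]
    ring_nf

theorem card_powersetCard_fin_le (r : ℕ) :
    (((Finset.univ : Finset (Fin p)).powersetCard r).card : ℝ) ≤ (p : ℝ) ^ r := by
  rw [Finset.card_powersetCard, Finset.card_univ, Fintype.card_fin]
  exact_mod_cast Nat.choose_le_pow p r

/-- With high probability, all coordinates of all scores are small. -/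
theorem exists_scoreBound_event (hsymm : Θ.IsSymm) (hdiag : ∀ j, Θ j j = 0)
    (hmeas : ∀ i, Measurable (X i)) (hindep : iIndepFun X P)
    (hlaw : ∀ i x, P.real {ω | X i ω = x} = isingProb ζ Θ x) {a u : ℝ} (ha : 0 < a) (hu : 0 < u)
    (hau : a * u ≤ 1) :
    ∃ B : Set Ω, P.real B ≤ p * (2 * (1 + p)) * Real.exp (-(a ^ 2 * u ^ 2 * n)) ∧ ∀ ω ∉ B, ∀ j,
      ScoreBound (nodeParam ζ Θ j) j (fun i => X i ω) (2 * a * u * n) := by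
  set E := Real.exp (-(a ^ 2 * u ^ 2 * n))
  have hE : 0 ≤ E := (Real.exp_pos _).le
  let A : Fin p → ℝ × (Fin p → ℝ) → Set Ω := fun j d =>
    {ω | a ^ 2 * u ^ 2 * n < totalGain (nodeParam ζ Θ j) j d fun i => X i ω}
  have hA : ∀ j d, d.2 j = 0 → P.real (A j d) ≤ E := fun j d hd =>
    measureReal_totalGain_gt_le hsymm hdiag hmeas hindep hlaw hd _
  refine ⟨⋃ j ∈ Finset.univ, ⋃ s ∈ ({a * u, -(a * u)} : Finset ℝ),
    (A j (s, 0) ∪ ⋃ k ∈ Finset.univ.erase j, A j (0, Pi.single k s)), ?_, fun ω hω j =>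
      scoreBound_of_totalGain ha hu hau fun s hs => ?_⟩
  · have h1 : ∀ (j : Fin p) (s : ℝ), P.real (A j (s, 0) ∪ ⋃ k ∈ Finset.univ.erase j,
        A j (0, Pi.single k s)) ≤ (1 + p) * E := by
      intro j s
      refine (measureReal_union_le _ _).trans ?_
      have l1 := hA j (s, 0) rfl
      have l2 := measureReal_biUnion_le_card_mul (P := P) (Finset.univ.erase j)
        (fun k => A j (0, Pi.single k s)) (E := E) fun k hk => hA j _ (by
          simp [Ne.symm (Finset.ne_of_mem_erase hk)])
      have l3 : ((Finset.univ.erase j).card : ℝ) ≤ p := by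
        exact_mod_cast (Finset.card_le_univ _).trans_eq (Fintype.card_fin p)
      have l4 := mul_le_mul_of_nonneg_right l3 hE
      linarith
    have h2 : ∀ j : Fin p, P.real (⋃ s ∈ ({a * u, -(a * u)} : Finset ℝ),
        (A j (s, 0) ∪ ⋃ k ∈ Finset.univ.erase j, A j (0, Pi.single k s)))
          ≤ 2 * ((1 + p) * E) := by
      intro j
      refine (measureReal_biUnion_le_card_mul _ _ fun s _ => h1 j s).trans ?_
      have : (({a * u, -(a * u)} : Finset ℝ).card : ℝ) ≤ 2 := by exact_mod_cast Finset.card_le_two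
      gcongr
    refine (measureReal_biUnion_le_card_mul _ _ fun j _ => h2 j).trans_eq ?_
    rw [Finset.card_univ, Fintype.card_fin]
    ring
  · simp only [Set.mem_iUnion, not_exists, Set.mem_union, not_or] at hω
    obtain ⟨h1, h2⟩ := hω j (Finset.mem_univ j) s hs
    exact ⟨not_lt.1 h1, fun k hk => not_lt.1 (h2 k (by simpa using hk))⟩

/-- With high probability, all patterns on small sets of nodes have a frequency bounded below. -/
theorem exists_patternFreq_event (hsymm : Θ.IsSymm) (hdiag : ∀ j, Θ j j = 0)
    (hmeas : ∀ i, Measurable (X i)) (hindep : iIndepFun X P)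
    (hlaw : ∀ i x, P.real {ω | X i ω = x} = isingProb ζ Θ x) {M : ℝ}
    (hM : ∀ j x, |linPred (nodeParam ζ Θ j) x| ≤ M) (hp : 1 ≤ p) {m : ℕ} {ν : ℝ}
    (hν : ν = ((1 + Real.exp M)⁻¹) ^ m / 4) :
    ∃ B : Set Ω, P.real B ≤ (m + 1) * (p ^ m * (1 + p)) * Real.exp (-(ν * n)) ∧ ∀ ω ∉ B,
      ∀ U : Finset (Fin p), U.card ≤ m → PatternFreq (fun i => X i ω) U ν := by
  set E := Real.exp (-(ν * n))
  have hE : 0 ≤ E := (Real.exp_pos _).le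
  have hp' : (1 : ℝ) ≤ p := by exact_mod_cast hp
  let A : Finset (Fin p) → (Fin p → Fin 2) → Set Ω := fun U y =>
    {ω | ((Finset.univ.filter fun i => ∀ l ∈ U, X i ω l = y l).card : ℝ) < ν * n}
  refine ⟨⋃ r ∈ Finset.range (m + 1), ⋃ U ∈ (Finset.univ : Finset (Fin p)).powersetCard r,
    (A U 0 ∪ ⋃ k ∈ (Finset.univ : Finset (Fin p)), A U (Pi.single k 1)), ?_, fun ω hω U hU => ?_⟩
  · have h1 : ∀ r ∈ Finset.range (m + 1), P.real (⋃ U ∈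
        (Finset.univ : Finset (Fin p)).powersetCard r,
        (A U 0 ∪ ⋃ k ∈ (Finset.univ : Finset (Fin p)), A U (Pi.single k 1)))
          ≤ p ^ m * ((1 + p) * E) := by
      intro r hr
      have hrm : r ≤ m := Nat.lt_succ_iff.1 (Finset.mem_range.1 hr)
      refine (measureReal_biUnion_le_card_mul _ _ (E := (1 + p) * E) fun U hU => ?_).trans ?_
      · have hUm : U.card ≤ m := by rw [(Finset.mem_powersetCard.1 hU).2]; exact hrm
        have hA : ∀ y, P.real (A U y) ≤ E := fun y =>
          measureReal_pattern_lt_le hsymm hdiag hmeas hindep hlaw hM hUm y hν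
        refine (measureReal_union_le _ _).trans ?_
        have l1 := hA 0
        have l2 := measureReal_biUnion_le_card_mul (P := P) (Finset.univ : Finset (Fin p))
          (fun k => A U (Pi.single k 1)) (E := E) fun k _ => hA _
        rw [Finset.card_univ, Fintype.card_fin] at l2
        linarith
      · refine mul_le_mul_of_nonneg_right ?_ (by positivity)
        exact (card_powersetCard_fin_le r).trans (pow_le_pow_right₀ hp' hrm)
    refine (measureReal_biUnion_le_card_mul _ _ h1).trans_eq ?_
    rw [Finset.card_range]
    push_cast
    ring
  · simp only [Set.mem_iUnion, not_exists, Set.mem_union, not_or] at hω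
    obtain ⟨h1, h2⟩ := hω U.card (Finset.mem_range.2 (Nat.lt_succ_iff.2 hU)) U
      (Finset.mem_powersetCard.2 ⟨Finset.subset_univ _, rfl⟩)
    exact ⟨not_lt.1 h1, fun k _ => not_lt.1 (h2 k (Finset.mem_univ k))⟩

/-- With high probability, no parameter in the nets has a large likelihood. -/
theorem exists_net_event (hsymm : Θ.IsSymm) (hdiag : ∀ j, Θ j j = 0)
    (hmeas : ∀ i, Measurable (X i)) (hindep : iIndepFun X P)
    (hlaw : ∀ i x, P.real {ω | X i ω = x} = isingProb ζ Θ x) (q N : ℕ) (ρ : ℝ) (t : ℕ → ℝ)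
    {E : ℝ} (ht : ∀ r, 1 ≤ r → r ≤ q → (p : ℝ) ^ r * Real.exp (-t r) ≤ E) :
    ∃ B : Set Ω, P.real B ≤ p * (q * ((2 * N + 1) ^ (q + 1) * E)) ∧ ∀ ω ∉ B,
      ∀ j, ∀ R : Finset (Fin p), 1 ≤ R.card → R.card ≤ q → j ∉ R →
      (neighborhood Θ j ∪ R).card ≤ q → ∀ e ∈ cubeNet (neighborhood Θ j ∪ R) ρ N,
        totalGain (nodeParam ζ Θ j) j e (fun i => X i ω) ≤ t R.card := by
  -- The admissibility conditions are put inside the event, so that inadmissible `R` contribute the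
  -- empty set and the union can run over all sets of size `r`.
  let A : Fin p → ℕ → Finset (Fin p) → ℝ × (Fin p → ℝ) → Set Ω := fun j r R e =>
    {ω | (j ∉ R ∧ (neighborhood Θ j ∪ R).card ≤ q) ∧
      t r < totalGain (nodeParam ζ Θ j) j e fun i => X i ω}
  refine ⟨⋃ j ∈ (Finset.univ : Finset (Fin p)), ⋃ r ∈ Finset.Icc 1 q,
    ⋃ R ∈ (Finset.univ : Finset (Fin p)).powersetCard r,
    ⋃ e ∈ cubeNet (neighborhood Θ j ∪ R) ρ N, A j r R e, ?_, fun ω hω j R h1 hq hj hc e he => ?_⟩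
  · have h1 : ∀ j r R, P.real (⋃ e ∈ cubeNet (neighborhood Θ j ∪ R) ρ N, A j r R e)
        ≤ (2 * N + 1) ^ (q + 1) * Real.exp (-t r) := by
      intro j r R
      by_cases hR : j ∉ R ∧ (neighborhood Θ j ∪ R).card ≤ q
      · refine (measureReal_biUnion_le_card_mul _ _ (E := Real.exp (-t r)) fun e he => ?_).trans ?_
        · refine (measureReal_mono fun ω hω => hω.2).trans
            (measureReal_totalGain_gt_le hsymm hdiag hmeas hindep hlaw
              (snd_eq_zero_of_mem_cubeNet he ?_) (t r))
          rw [Finset.mem_union, not_or]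
          exact ⟨self_notMem_neighborhood j, hR.1⟩
        · refine mul_le_mul_of_nonneg_right ?_ (Real.exp_pos _).le
          have := (card_cubeNet_le (neighborhood Θ j ∪ R) ρ N).trans
            (Nat.pow_le_pow_right (by omega) (Nat.succ_le_succ hR.2))
          exact_mod_cast this
      · have : ∀ e, A j r R e = ∅ := fun e =>
          Set.eq_empty_iff_forall_notMem.2 fun ω hω => hR hω.1
        simp only [this, Set.iUnion_empty, measureReal_empty]
        positivity
    have h2 : ∀ j, ∀ r ∈ Finset.Icc 1 q, P.real (⋃ R ∈
        (Finset.univ : Finset (Fin p)).powersetCard r,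
        ⋃ e ∈ cubeNet (neighborhood Θ j ∪ R) ρ N, A j r R e) ≤ (2 * N + 1) ^ (q + 1) * E := by
      intro j r hr
      rw [Finset.mem_Icc] at hr
      refine (measureReal_biUnion_le_card_mul _ _ fun R _ => h1 j r R).trans ?_
      calc _ ≤ (p : ℝ) ^ r * ((2 * N + 1) ^ (q + 1) * Real.exp (-t r)) :=
            mul_le_mul_of_nonneg_right (card_powersetCard_fin_le r) (by positivity)
        _ = (2 * N + 1) ^ (q + 1) * ((p : ℝ) ^ r * Real.exp (-t r)) := by ring
        _ ≤ _ := mul_le_mul_of_nonneg_left (ht r hr.1 hr.2) (by positivity)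
    have h3 := measureReal_biUnion_le_card_mul (P := P) (Finset.univ : Finset (Fin p)) _ fun j _ =>
      measureReal_biUnion_le_card_mul (Finset.Icc 1 q) _ (h2 j)
    refine h3.trans_eq ?_
    simp
  · simp only [Set.mem_iUnion, not_exists] at hω
    exact not_lt.1 fun h => hω j (Finset.mem_univ j) R.card (Finset.mem_Icc.2 ⟨h1, hq⟩) R
      (Finset.mem_powersetCard.2 ⟨Finset.subset_univ _, rfl⟩) e he ⟨⟨hj, hc⟩, h⟩

/-- A finite-sample bound for the probability that the true neighborhoods have the smallest
extended BIC, by a margin of more than `μ`. -/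
theorem le_measureReal_beatsBy (hsymm : Θ.IsSymm) (hdiag : ∀ j, Θ j j = 0)
    (hmeas : ∀ i, Measurable (X i)) (hindep : iIndepFun X P)
    (hlaw : ∀ i x, P.real {ω | X i ω = x} = isingProb ζ Θ x) {q : ℕ}
    (hq : ∀ j, (neighborhood Θ j).card ≤ q) {M : ℝ}
    (hM : ∀ j x, |linPred (nodeParam ζ Θ j) x| ≤ M) {a u W C ν η γ μ E : ℝ} {N : ℕ} (hn : 0 < n)
    (hp : 1 ≤ p) (hν : ν = ((1 + Real.exp M)⁻¹) ^ (2 * q) / 4) (hu : 0 < u) (ha : 0 < a)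
    (hau : a * u ≤ 1) (hW : 0 < W)
    (hWu : ((2 * q : ℕ) + 1) * (W * u) ≤ 1) (hC : 0 ≤ C) (hη : 0 < η) (hN : 0 < N)
    (hWC : ((2 * q : ℕ) + 1) * (W * (2 * a)) - Real.exp (-M) / 32 * (ν / 4 * W ^ 2) ≤ -C)
    (hNη : ((q + 1) * (2 * a) + (q + 1) ^ 2 * W) * (W / N) ≤ η)
    (hθ : ∀ j, ∀ k ∈ neighborhood Θ j, W * u ≤ |Θ j k|)
    (hB : q * |Real.log n + 2 * γ * Real.log p| + |μ| < 2 * C * (u ^ 2 * n))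
    (ht : ∀ r : ℕ, 1 ≤ r → r ≤ q → (p : ℝ) ^ r * Real.exp
      (-((r * (Real.log n + 2 * γ * Real.log p) - μ) / 2 - 2 * η * (u ^ 2 * n))) ≤ E) :
    1 - (p * (2 * (1 + p)) * Real.exp (-(a ^ 2 * u ^ 2 * n))
        + ((2 * q : ℕ) + 1) * (p ^ (2 * q) * (1 + p)) * Real.exp (-(ν * n))
        + p * (q * ((2 * N + 1) ^ (q + 1) * E)))
      ≤ P.real {ω | BeatsBy γ q (fun i => X i ω) (neighborhood Θ) μ} := by
  obtain ⟨B₁, hB₁, h₁⟩ := exists_scoreBound_event hsymm hdiag hmeas hindep hlaw ha hu hau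
  obtain ⟨B₂, hB₂, h₂⟩ := exists_patternFreq_event hsymm hdiag hmeas hindep hlaw hM hp hν
  obtain ⟨B₃, hB₃, h₃⟩ := exists_net_event hsymm hdiag hmeas hindep hlaw q N (W * u)
    (fun r => (r * (Real.log n + 2 * γ * Real.log p) - μ) / 2 - 2 * η * (u ^ 2 * n)) ht
  set G := {ω | BeatsBy γ q (fun i => X i ω) (neighborhood Θ) μ}
  have hcover : (Set.univ : Set Ω) ⊆ G ∪ (B₁ ∪ B₂ ∪ B₃) := by
    intro ω _
    by_contra hω
    simp only [Set.mem_union, not_or] at hω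
    obtain ⟨hG, ⟨n₁, n₂⟩, n₃⟩ := hω
    exact hG (beatsBy_of_good hdiag hq hM hn (by rw [hν]; positivity) hu ha.le hW hWu hC hη hN
      hWC hNη hθ hB (h₁ ω n₁) (h₂ ω n₂) (h₃ ω n₃))
  have l0 := measureReal_mono (μ := P) hcover
  have l1 := measureReal_union_le (μ := P) G (B₁ ∪ B₂ ∪ B₃)
  have l2 := measureReal_union_le (μ := P) (B₁ ∪ B₂) B₃
  have l3 := measureReal_union_le (μ := P) B₁ B₂
  rw [probReal_univ] at l0
  linarith

end Probability

/-! ### Choice of constants and the limit of large samples -/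

section Asymptotics

/-- Provides the radius `W` at which the curvature term exceeds the score term by the required drop.
-/
theorem exists_pos_mul_sub_mul_sq_le {b κ C : ℝ} (hC : 0 ≤ C) (hκ : 0 < κ) :
    ∃ W : ℝ, 0 < W ∧ b * W - κ * W ^ 2 ≤ -C := by
  refine ⟨max 1 ((b + C) / κ), lt_max_of_lt_left one_pos, ?_⟩
  set W := max 1 ((b + C) / κ)
  have h1 : 1 ≤ W := le_max_left _ _
  have h2 : b + C ≤ κ * W := by
    rw [← div_le_iff₀' hκ]; exact le_max_right _ _
  nlinarith [mul_le_mul_of_nonneg_right h2 (by linarith : 0 ≤ W), mul_nonneg hC (sub_nonneg.2 h1)]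

theorem exists_nat_mul_div_le {b W η : ℝ} (hη : 0 < η) :
    ∃ N : ℕ, 0 < N ∧ b * (W / N) ≤ η := by
  obtain ⟨N, hN⟩ := exists_nat_gt (max 0 (b * W / η))
  have hN0 : (0 : ℝ) < N := (le_max_left _ _).trans_lt hN
  refine ⟨N, by exact_mod_cast hN0, ?_⟩
  have := (le_max_right _ _).trans_lt hN
  rw [div_lt_iff₀ hη] at this
  rw [← mul_div_assoc, div_le_iff₀ hN0]
  linarith

theorem norm_nodeParam_le {p : ℕ} {ζ : Fin p → ℝ} {Θ : Matrix (Fin p) (Fin p) ℝ} {c : ℝ}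
    (h1 : ∀ j, |ζ j| ≤ c) (h2 : ∀ j k, |Θ j k| ≤ c) (j : Fin p) : ‖nodeParam ζ Θ j‖ ≤ c :=
  max_le (h1 j) ((pi_norm_le_iff_of_nonneg ((abs_nonneg _).trans (h1 j))).2 (h2 j))

theorem rpow_neg_mul_rpow_neg_eq_exp {n p : ℕ} (hn : 1 ≤ n) (hp : 1 ≤ p) (α β : ℝ) :
    (n : ℝ) ^ (-α) * (p : ℝ) ^ (-(β - 1))
      = Real.exp (-(α * Real.log n + (β - 1) * Real.log p)) := by
  rw [Real.rpow_def_of_pos (by exact_mod_cast hn), Real.rpow_def_of_pos (by exact_mod_cast hp),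
    ← Real.exp_add]
  ring_nf

theorem tendsto_log_add_log (p : ℕ → ℕ) :
    Tendsto (fun n : ℕ => Real.log n + Real.log (p n)) atTop atTop :=
  tendsto_atTop_mono (fun n => le_add_of_nonneg_right (Real.log_natCast_nonneg (p n)))
    (Real.tendsto_log_atTop.comp tendsto_natCast_atTop_atTop)

theorem log_add_log_isLittleO {p : ℕ → ℕ}
    (hC1 : (fun n : ℕ => Real.log (p n)) =o[atTop] (fun n : ℕ => (n : ℝ))) :
    (fun n : ℕ => Real.log n + Real.log (p n)) =o[atTop] (fun n : ℕ => (n : ℝ)) :=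
  (Real.isLittleO_log_id_atTop.comp_tendsto tendsto_natCast_atTop_atTop).add hC1

/-- The three error terms of the finite-sample bound are together at most `exp (-s)`. -/
theorem error_terms_le {p A L ν n s T₃ : ℝ} {k : ℕ} (hp : 1 ≤ p) (hpL : Real.log p ≤ L)
    (hA : s + 4 * L ≤ A) (hν : (k + 2) * L + s ≤ ν * n)
    (hL : Real.exp (-L) * (16 + 8 * (k + 1)) ≤ 1)
    (hT₃ : T₃ ≤ Real.exp (-s) / 4) :
    p * (2 * (1 + p)) * Real.exp (-A) + (k + 1) * (p ^ k * (1 + p)) * Real.exp (-(ν * n)) + T₃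
      ≤ Real.exp (-s) := by
  have hp0 : 0 < p := by linarith
  have hpe : p ≤ Real.exp L := by rwa [← Real.log_le_iff_le_exp hp0]
  have hL0 : 0 ≤ L := (Real.log_nonneg hp).trans hpL
  have hk : (0 : ℝ) ≤ k := k.cast_nonneg
  have e0 := Real.exp_pos (-L)
  have e1 : Real.exp (-L) ≤ 1 := Real.exp_le_one_iff.2 (by linarith)
  have es := Real.exp_pos (-s)
  have t1 : p * (2 * (1 + p)) * Real.exp (-A) ≤ 4 * Real.exp (-L) * Real.exp (-s) := by
    calc p * (2 * (1 + p)) * Real.exp (-A)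
        ≤ Real.exp L * (2 * (Real.exp L + Real.exp L)) * Real.exp (-(s + 4 * L)) := by
          gcongr
          linarith
      _ = 4 * (Real.exp L * Real.exp L * Real.exp (-(s + 4 * L))) := by ring
      _ = 4 * Real.exp (-2 * L - s) := by
          rw [← Real.exp_add, ← Real.exp_add]; ring_nf
      _ ≤ 4 * Real.exp (-L - s) := by gcongr; linarith
      _ = _ := by rw [sub_eq_add_neg, Real.exp_add]; ring
  have t2 : (k + 1) * (p ^ k * (1 + p)) * Real.exp (-(ν * n))
      ≤ 2 * (k + 1) * Real.exp (-L) * Real.exp (-s) := by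
    calc (k + 1) * (p ^ k * (1 + p)) * Real.exp (-(ν * n))
        ≤ (k + 1) * (Real.exp L ^ k * (Real.exp L + Real.exp L)) * Real.exp (-((k + 2) * L + s)) := by
          gcongr
          linarith
      _ = 2 * (k + 1) * (Real.exp L ^ k * Real.exp L * Real.exp (-((k + 2) * L + s))) := by ring
      _ = 2 * (k + 1) * (Real.exp (-L) * Real.exp (-s)) := by
          rw [← Real.exp_nat_mul, ← Real.exp_add, ← Real.exp_add, ← Real.exp_add]; ring_nf
      _ = _ := by ring
  nlinarith [mul_le_mul_of_nonneg_right hL es.le]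

set_option maxHeartbeats 800000 in
/-- The selection result, under an abstract lower bound for the penalty differences. -/
theorem eventually_le_measureReal_beatsBy {p : ℕ → ℕ} (hp : ∀ n, 1 ≤ p n)
    {ζ : ∀ n, Fin (p n) → ℝ} {Θ : ∀ n, Matrix (Fin (p n)) (Fin (p n)) ℝ}
    (hsymm : ∀ n, (Θ n).IsSymm) (hdiag : ∀ n j, Θ n j j = 0) {q : ℕ} {c : ℝ}
    (hC1 : (fun n : ℕ => Real.log (p n)) =o[atTop] (fun n : ℕ => (n : ℝ)))
    (hC2 : ∀ n j, (neighborhood (Θ n) j).card ≤ q)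
    (hC3 : ∀ n, (∀ j, |ζ n j| ≤ c) ∧ ∀ j k, |Θ n j k| ≤ c)
    (hC4 : ∀ ε : ℝ, 0 < ε → ∀ᶠ n : ℕ in atTop, ∀ j k, (isingGraph (Θ n)).Adj j k →
      Real.sqrt (Real.log ((n : ℝ) * (p n : ℝ)) / n) ≤ ε * |Θ n j k|)
    {Ω : ℕ → Type*} [∀ n, MeasurableSpace (Ω n)]
    {P : ∀ n, Measure (Ω n)} [∀ n, IsProbabilityMeasure (P n)]
    {X : ∀ n, Fin n → Ω n → (Fin (p n) → Fin 2)}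
    (hmeas : ∀ n i, Measurable (X n i)) (hindep : ∀ n, iIndepFun (X n) (P n))
    (hlaw : ∀ n i x, (P n).real {ω | X n i ω = x} = isingProb (ζ n) (Θ n) x)
    {α β γ K c₀ : ℝ} {μ : ℕ → ℝ} (hc₀ : 0 < c₀) (hK : 0 ≤ K)
    (hμ : ∀ᶠ n : ℕ in atTop, |μ n| ≤ K * (Real.log n + Real.log (p n)))
    (hpen : ∀ᶠ n : ℕ in atTop, 0 < α * Real.log n + (β - 1) * Real.log (p n) →
      ∀ r : ℕ, 1 ≤ r → r ≤ q →
        2 * α * Real.log n + 2 * β * Real.log (p n) + 2 * r * Real.log (p n)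
            + c₀ * (Real.log n + Real.log (p n))
          ≤ r * (Real.log n + 2 * γ * Real.log (p n)) - μ n) :
    ∀ᶠ n : ℕ in atTop, 1 - (n : ℝ) ^ (-α) * (p n : ℝ) ^ (-(β - 1)) ≤
      (P n).real {ω | BeatsBy γ q (fun i => X n i ω) (neighborhood (Θ n)) (μ n)} := by
  have hc : 0 ≤ c := (abs_nonneg _).trans ((hC3 0).1 ⟨0, hp 0⟩)
  set M : ℝ := (q + 1) * c with hMdef
  set ν : ℝ := ((1 + Real.exp M)⁻¹) ^ (2 * q) / 4 with hν
  have hν0 : 0 < ν := by positivity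
  -- With this choice a² L covers the target exponent plus 4 L, and the 4 L absorbs the number of
  -- score coordinates.
  set a : ℝ := Real.sqrt (|α| + |β - 1| + 4) with hadef
  have ha2 : a ^ 2 = |α| + |β - 1| + 4 := Real.sq_sqrt (by positivity)
  have ha : 0 < a := Real.sqrt_pos.2 (by positivity)
  -- The drop C L must dominate all penalty differences together with the margin, which is at most K
  -- L.
  set C : ℝ := q * (1 + 2 * |γ|) + K + 1 with hCdef
  have hC : 0 ≤ C := by positivity
  -- The slack contributes c₀ L / 2 to the exponent. The net uses 2 η L = c₀ L / 4, and the
  -- remaining c₀ L / 4 makes the constant net cardinality negligible.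
  set η : ℝ := c₀ / 8 with hηdef
  have hη : 0 < η := by positivity
  obtain ⟨W, hW, hWC⟩ := exists_pos_mul_sub_mul_sq_le (b := ((2 * q : ℕ) + 1) * (2 * a)) hC
    (κ := Real.exp (-M) / 32 * (ν / 4)) (by positivity)
  obtain ⟨N, hN, hNη⟩ := exists_nat_mul_div_le (b := (q + 1) * (2 * a) + (q + 1) ^ 2 * W) (W := W) hη
  have hLtop := tendsto_log_add_log p
  have hLo := log_add_log_isLittleO hC1
  have hexp : Tendsto (fun n : ℕ => Real.exp (-(Real.log n + Real.log (p n)))) atTop (𝓝 0) :=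
    Real.tendsto_exp_neg_atTop_nhds_zero.comp hLtop
  have hexp2 : Tendsto (fun n : ℕ => Real.exp (-(c₀ / 4 * (Real.log n + Real.log (p n))))) atTop
      (𝓝 0) :=
    Real.tendsto_exp_neg_atTop_nhds_zero.comp (hLtop.const_mul_atTop (by positivity))
  set D : ℝ := ((2 * q : ℕ) + 1) * W + a with hD
  have hDpos : 0 < D := by positivity
  set F : ℝ := ((2 * q : ℕ) + 2) + |α| + |β - 1| with hF
  have hFpos : 0 < F := by positivity
  have hq4 := (hexp2.mul_const ((q : ℝ) * (2 * N + 1) ^ (q + 1))).eventually_lt_const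
    (show 0 * ((q : ℝ) * (2 * N + 1) ^ (q + 1)) < 1 / 4 by norm_num)
  have hq5 := (hexp.mul_const (16 + 8 * (((2 * q : ℕ) : ℝ) + 1))).eventually_lt_const
    (show 0 * (16 + 8 * (((2 * q : ℕ) : ℝ) + 1)) < 1 by norm_num)
  filter_upwards [eventually_ge_atTop 1, hμ, hpen, hC4 (1 / W) (by positivity),
    hLtop.eventually_gt_atTop 0, hLo.bound (show 0 < 1 / D ^ 2 by positivity),
    hLo.bound (show 0 < ν / F by positivity), hq4, hq5]
    with n hn hμn hpenn hθn hL hLD hLF hE3 hE5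
  have hn0 : (0 : ℝ) < n := by exact_mod_cast hn
  have hp1 : (1 : ℝ) ≤ p n := by exact_mod_cast hp n
  rw [rpow_neg_mul_rpow_neg_eq_exp hn (hp n)]
  have hl := Real.log_natCast_nonneg n
  have hlp := Real.log_natCast_nonneg (p n)
  set l := Real.log n with hldef
  set lp := Real.log (p n) with hlpdef
  -- If the exponent is not positive, the claimed lower bound for the probability is at most zero.
  rcases le_or_gt (α * l + (β - 1) * lp) 0 with hT | hT
  · have : 1 ≤ Real.exp (-(α * l + (β - 1) * lp)) := Real.one_le_exp (by linarith)
    linarith [measureReal_nonneg (μ := P n)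
      (s := {ω | BeatsBy γ q (fun i => X n i ω) (neighborhood (Θ n)) (μ n)})]
  replace hpenn := hpenn hT
  rw [Real.norm_of_nonneg hL.le, Real.norm_of_nonneg hn0.le] at hLD hLF
  set L := l + lp with hLdef
  set u := Real.sqrt (L / n) with hudef
  have hu : 0 < u := Real.sqrt_pos.2 (by positivity)
  have hu2 : u ^ 2 * n = L := by
    rw [hudef, Real.sq_sqrt (by positivity), div_mul_cancel₀ _ hn0.ne']
  have hDu : D * u ≤ 1 := by
    have : L / n ≤ (1 / D) ^ 2 := by
      rw [div_le_iff₀ hn0, one_div_pow]; exact hLD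
    have h2 : u ≤ 1 / D := Real.sqrt_le_iff.2 ⟨by positivity, this⟩
    rw [le_div_iff₀ hDpos] at h2
    linarith
  have hWu0 : 0 ≤ ((2 * q : ℕ) + 1 : ℝ) * W * u := by positivity
  have hau0 : 0 ≤ a * u := by positivity
  have hM : ∀ j x, |linPred (nodeParam (ζ n) (Θ n) j) x| ≤ M := fun j x => by
    refine (abs_linPred_le (hC2 n j) (fun k hk => ?_) x).trans ?_
    · exact eq_zero_of_notMem_neighborhood (hdiag n) hk
    · exact mul_le_mul_of_nonneg_left (norm_nodeParam_le (hC3 n).1 (hC3 n).2 j) (by positivity)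
  have hsb : α * l + (β - 1) * lp ≤ (|α| + |β - 1|) * L := by
    have h1 := mul_le_mul_of_nonneg_right (le_abs_self α) hl
    have h2 := mul_le_mul_of_nonneg_right (le_abs_self (β - 1)) hlp
    have h3 := mul_nonneg (abs_nonneg α) hlp
    have h4 := mul_nonneg (abs_nonneg (β - 1)) hl
    rw [hLdef]
    linarith
  have hnet : ∀ r : ℕ, 1 ≤ r → r ≤ q → (p n : ℝ) ^ r * Real.exp
      (-((r * (l + 2 * γ * lp) - μ n) / 2 - 2 * η * (u ^ 2 * n)))
        ≤ Real.exp (-(α * l + β * lp + c₀ / 4 * L)) := by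
    intro r h1 h2
    have h3 := hpenn r h1 h2
    have h4 : (p n : ℝ) ^ r = Real.exp (r * lp) := by
      rw [Real.exp_nat_mul, hlpdef, Real.exp_log (by linarith)]
    rw [h4, ← Real.exp_add, hu2]
    apply Real.exp_le_exp.2
    rw [hηdef]
    linarith
  have main := le_measureReal_beatsBy (hsymm n) (hdiag n) (hmeas n) (hindep n) (hlaw n) (hC2 n) hM
    (a := a) (u := u) (W := W) (C := C) (η := η) (γ := γ) (μ := μ n) (N := N) hn (hp n) hν hu ha
    (by linarith) hW (by linarith) hC hη hN (by linarith) hNη ?_ ?_ hnet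
  · refine le_trans ?_ main
    refine sub_le_sub_left (error_terms_le hp1 (L := L) (by linarith) ?_ ?_ hE5.le ?_) _
    · rw [mul_assoc, hu2, ha2]
      linarith
    · rw [div_mul_eq_mul_div, le_div_iff₀ hFpos] at hLF
      linarith
    -- The union over the `p` nodes is what turns β into β - 1.
    · have h1 : (p n : ℝ) * Real.exp (-(α * l + β * lp + c₀ / 4 * L))
          = Real.exp (-(α * l + (β - 1) * lp)) * Real.exp (-(c₀ / 4 * L)) := by
        nth_rewrite 1 [← Real.exp_log (show (0 : ℝ) < p n by linarith)]
        rw [← Real.exp_add, ← Real.exp_add, ← hlpdef]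
        ring_nf
      calc _ = (p n : ℝ) * Real.exp (-(α * l + β * lp + c₀ / 4 * L))
            * (q * (2 * N + 1) ^ (q + 1)) := by ring
        _ = Real.exp (-(α * l + (β - 1) * lp)) * (Real.exp (-(c₀ / 4 * L))
            * (q * (2 * N + 1) ^ (q + 1))) := by rw [h1]; ring
        _ ≤ Real.exp (-(α * l + (β - 1) * lp)) * (1 / 4) :=
            mul_le_mul_of_nonneg_left hE3.le (Real.exp_pos _).le
        _ = _ := by ring
  · intro j k hk
    obtain ⟨h1, h2⟩ := mem_neighborhood.1 hk
    have h3 := hθn j k ((SimpleGraph.fromRel_adj _ _ _).2 ⟨h1.symm, Or.inl h2⟩)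
    rw [Real.log_mul hn0.ne' (by linarith), one_div, ← hldef, ← hlpdef, ← hLdef, ← hudef,
      inv_mul_eq_div, le_div_iff₀ hW] at h3
    linarith
  · rw [hu2]
    have h1 : |l + 2 * γ * lp| ≤ (1 + 2 * |γ|) * L := by
      refine (abs_add_le _ _).trans ?_
      rw [abs_mul, abs_mul, abs_of_nonneg hl, abs_of_nonneg hlp, abs_two, hLdef]
      linarith [mul_nonneg (abs_nonneg γ) hl]
    have h2 := mul_le_mul_of_nonneg_left h1 (Nat.cast_nonneg (α := ℝ) q)
    have h3 : 0 ≤ (q : ℝ) * ((1 + 2 * |γ|) * L) := by positivity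
    have h4 : 0 ≤ K * L := by positivity
    rw [hCdef]
    linarith

end Asymptotics

/-! ### Slack in the penalty from the definition of κ -/

section Kappa

variable {p : ℕ → ℕ}

theorem eventually_log_natCast_pos : ∀ᶠ n : ℕ in atTop, 0 < Real.log n := by
  filter_upwards [eventually_ge_atTop 2] with n hn
  exact Real.log_pos (by exact_mod_cast hn)

theorem eventually_log_le_of_kappa_lt {t : ℝ} (ht : 0 < t) (h : kappa p < ENNReal.ofReal t) :
    ∀ᶠ n : ℕ in atTop, Real.log (p n) ≤ t * Real.log n := by
  filter_upwards [eventually_lt_of_limsup_lt h, eventually_log_natCast_pos] with n hn hl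
  rw [kappaSeq, ENNReal.ofReal_lt_ofReal_iff ht, div_lt_iff₀ hl] at hn
  exact hn.le

theorem eventually_le_log_of_lt_kappa (hconv : Tendsto (kappaSeq p) atTop (𝓝 (kappa p))) {t : ℝ}
    (h : ENNReal.ofReal t < kappa p) : ∀ᶠ n : ℕ in atTop, t * Real.log n ≤ Real.log (p n) := by
  filter_upwards [hconv.eventually_const_lt h, eventually_log_natCast_pos] with n hn hl
  rw [← le_div_iff₀ hl]
  by_contra hlt
  exact hn.not_ge (ENNReal.ofReal_le_ofReal (not_le.1 hlt).le)

/-- The slack in the penalty is at least of the order `log (n p)`. -/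
theorem exists_slack (hκ : kappa p ≠ 0) {α ε : ℝ} (hε : 0 < ε)
    (hα : α < 1 / 2 ∨ Tendsto (kappaSeq p) atTop (𝓝 (kappa p))) :
    ∃ c₀ : ℝ, 0 < c₀ ∧ ∀ᶠ n : ℕ in atTop, c₀ * (Real.log n + Real.log (p n)) ≤
      (1 - 2 * α) * (Real.log n - invKappa p * Real.log (p n)) + ε * Real.log (p n) := by
  by_cases htop : kappa p = ⊤
  · have hik : invKappa p = 0 := by simp [invKappa, htop]
    rw [hik]
    rcases hα with hα | hconv
    · refine ⟨min (1 - 2 * α) ε, lt_min (by linarith) hε, Eventually.of_forall fun n => ?_⟩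
      have h1 := mul_le_mul_of_nonneg_right (min_le_left (1 - 2 * α) ε) (Real.log_natCast_nonneg n)
      have h2 := mul_le_mul_of_nonneg_right (min_le_right (1 - 2 * α) ε) (Real.log_natCast_nonneg (p n))
      linarith
    -- For κ = ∞ with convergence, log n is negligible against log p, so half of ε log p absorbs (1
    -- - 2α) log n whatever its sign.
    · refine ⟨ε / 2, by positivity, ?_⟩
      filter_upwards [eventually_le_log_of_lt_kappa hconv (t := 2 / ε * (|1 - 2 * α| + ε / 2))
        (by rw [htop]; exact ENNReal.ofReal_lt_top)] with n hn
      have h1 := mul_le_mul_of_nonneg_right (neg_abs_le (1 - 2 * α)) (Real.log_natCast_nonneg n)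
      have h2 := mul_le_mul_of_nonneg_left hn (by positivity : 0 ≤ ε / 2)
      have h3 : ε / 2 * (2 / ε * (|1 - 2 * α| + ε / 2) * Real.log n)
          = (|1 - 2 * α| + ε / 2) * Real.log n := by field_simp
      rw [h3] at h2
      linarith
  · set k := (kappa p).toReal with hk
    have hk0 : 0 < k := ENNReal.toReal_pos hκ htop
    have hkk : kappa p = ENNReal.ofReal k := (ENNReal.ofReal_toReal htop).symm
    have hik : invKappa p = k⁻¹ := by rw [invKappa, ENNReal.toReal_inv]
    have up : ∀ δ : ℝ, 0 < δ →
        ∀ᶠ n : ℕ in atTop, invKappa p * Real.log (p n) ≤ (1 + δ) * Real.log n := by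
      intro δ hδ
      filter_upwards [eventually_log_le_of_kappa_lt (p := p) (t := k * (1 + δ)) (by positivity)
        (by rw [hkk, ENNReal.ofReal_lt_ofReal_iff (by positivity)]; nlinarith)] with n hn
      rw [hik, inv_mul_le_iff₀ hk0]
      linarith
    have eq : ∀ n, Real.log (p n) = k * (invKappa p * Real.log (p n)) := fun n => by
      rw [hik]; field_simp
    set E := ε * k with hE
    have hE0 : 0 < E := by positivity
    -- For finite κ, eventually log p ≤ 2κ log n, so slack of order log n is enough.
    suffices h : ∃ c₁ : ℝ, 0 < c₁ ∧ ∀ᶠ n : ℕ in atTop, c₁ * Real.log n ≤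
        (1 - 2 * α) * (Real.log n - invKappa p * Real.log (p n)) + ε * Real.log (p n) by
      obtain ⟨c₁, hc₁, h⟩ := h
      refine ⟨c₁ / (1 + 2 * k), by positivity, ?_⟩
      filter_upwards [h, up 1 one_pos] with n hn hu
      refine le_trans ?_ hn
      rw [div_mul_eq_mul_div, div_le_iff₀ (by positivity), mul_assoc]
      refine mul_le_mul_of_nonneg_left ?_ hc₁.le
      rw [eq n]
      nlinarith
    -- For α < 1/2 only a large log p can make the first term negative, and the limsup bounds log p
    -- from above. For other α a small log p is harmful too, hence the need for convergence.
    rcases hα with hα | hconv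
    · set A := 1 - 2 * α with hA
      have hA0 : 0 < A := by rw [hA]; linarith
      refine ⟨min A (E / 2), lt_min hA0 (by positivity), ?_⟩
      filter_upwards [up (E / (2 * A)) (by positivity)] with n hn
      have hl := Real.log_natCast_nonneg n
      have hx : 0 ≤ invKappa p * Real.log (p n) :=
        mul_nonneg ENNReal.toReal_nonneg (Real.log_natCast_nonneg (p n))
      have e : ε * Real.log (p n) = E * (invKappa p * Real.log (p n)) := by
        rw [hE, mul_assoc, ← eq n]
      rw [e]
      set y := invKappa p * Real.log (p n)
      set l := Real.log n
      have m1 := mul_le_mul_of_nonneg_right (min_le_left A (E / 2)) hl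
      have m2 := mul_le_mul_of_nonneg_right (min_le_right A (E / 2)) hl
      have hAn : A * y ≤ A * l + E / 2 * l := by
        have h1 := mul_le_mul_of_nonneg_left hn hA0.le
        have h2 : A * ((1 + E / (2 * A)) * l) = A * l + E / 2 * l := by field_simp
        linarith
      rcases le_total y l with hyl | hyl
      · have m3 := mul_le_mul_of_nonneg_right (min_le_left A (E / 2)) (sub_nonneg.2 hyl)
        have m4 := mul_le_mul_of_nonneg_right (min_le_right A (E / 2)) hx
        nlinarith [mul_nonneg hE0.le hx]
      · nlinarith [mul_le_mul_of_nonneg_left hyl hE0.le]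
    · refine ⟨E / 4, by positivity, ?_⟩
      set B := |1 - 2 * α| + 1 with hB
      have hB0 : 0 < B := by positivity
      set δ := min (1 / 2) (E / (4 * B)) with hδ
      have hδ0 : 0 < δ := lt_min (by norm_num) (by positivity)
      filter_upwards [up δ hδ0, eventually_le_log_of_lt_kappa hconv (t := k * (1 - δ)) (by
        rw [hkk, ENNReal.ofReal_lt_ofReal_iff hk0]; nlinarith)] with n h1 h2
      have hl := Real.log_natCast_nonneg n
      have e : ε * Real.log (p n) = E * (invKappa p * Real.log (p n)) := by
        rw [hE, mul_assoc, ← eq n]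
      rw [eq n, mul_assoc] at h2
      replace h2 := le_of_mul_le_mul_left h2 hk0
      rw [e]
      set y := invKappa p * Real.log (p n)
      set l := Real.log n
      have d1 := mul_le_mul_of_nonneg_right (min_le_left (1 / 2) (E / (4 * B))) hl
      have d2 : B * (δ * l) ≤ E / 4 * l := by
        have h3 := mul_le_mul_of_nonneg_left (min_le_right (1 / 2) (E / (4 * B))) hB0.le
        have h4 : B * (E / (4 * B)) = E / 4 := by field_simp
        rw [h4] at h3
        have := mul_le_mul_of_nonneg_right h3 hl
        linarith
      have habs : |l - y| ≤ δ * l := by rw [abs_le]; constructor <;> linarith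
      have h5 : -(B * (δ * l)) ≤ (1 - 2 * α) * (l - y) := by
        refine (abs_le.1 ?_).1
        rw [abs_mul]
        exact mul_le_mul (by linarith) habs (abs_nonneg _) hB0.le
      have h6 : l / 2 ≤ y := by
        rw [← hδ] at d1
        linarith
      nlinarith [mul_le_mul_of_nonneg_left h6 hE0.le]

end Kappa

/-! ### From the score margin to the selected graph -/

section Selected

variable {n p : ℕ} {Θ : Matrix (Fin p) (Fin p) ℝ}

theorem andGraph_neighborhood (hsymm : Θ.IsSymm) :
    andGraph (neighborhood Θ) = isingGraph Θ := by
  ext j k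
  have h : Θ k j = Θ j k := hsymm.apply j k
  simp only [andGraph, isingGraph, SimpleGraph.fromRel_adj, mem_neighborhood, h]
  tauto

theorem orGraph_neighborhood (hsymm : Θ.IsSymm) :
    orGraph (neighborhood Θ) = isingGraph Θ := by
  ext j k
  have h : Θ k j = Θ j k := hsymm.apply j k
  simp only [orGraph, isingGraph, SimpleGraph.fromRel_adj, mem_neighborhood, h]
  tauto

theorem IsSelected.eq_neighborhood {γ μ : ℝ} {q : ℕ} {x : Fin n → Fin p → Fin 2}
    (hq : ∀ j, (neighborhood Θ j).card ≤ q) (hμ : 0 ≤ μ)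
    (hbeats : BeatsBy γ q x (neighborhood Θ) μ) {S : Fin p → Finset (Fin p)}
    (hS : IsSelected γ q x S) : S = neighborhood Θ := by
  funext j
  by_contra hne
  have h1 := hbeats j (S j) (hS j).1 hne
  have h2 := (hS j).2 _ ⟨self_notMem_neighborhood (Θ := Θ) j, hq j⟩
  linarith

end Selected

/-! ### The main theorem -/

theorem mainTheorem4
    -- the dimension `p = p_n` and the true parameters, for each sample size `n`
    (p : ℕ → ℕ) (hp : ∀ n, 1 ≤ p n)
    (ζ : ∀ n, Fin (p n) → ℝ) (Θ : ∀ n, Matrix (Fin (p n)) (Fin (p n)) ℝ)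
    (hsymm : ∀ n, (Θ n).IsSymm) (hdiag : ∀ n j, Θ n j j = 0)
    (q : ℕ) (c : ℝ)
    -- subexponential growth of `p`
    (hC1 : (fun n : ℕ => Real.log (p n)) =o[atTop] (fun n : ℕ => (n : ℝ)))
    -- degrees bounded by `q`
    (hC2 : ∀ n j, (neighborhood (Θ n) j).card ≤ q)
    -- bounded parameters
    (hC3 : ∀ n, (∀ j, |ζ n j| ≤ c) ∧ ∀ j k, |Θ n j k| ≤ c)
    -- `√(log (n p) / n) = o(min {|Θ j k| : (j, k) an edge})`
    (hC4 : ∀ ε : ℝ, 0 < ε → ∀ᶠ n : ℕ in atTop, ∀ j k, (isingGraph (Θ n)).Adj j k →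
      Real.sqrt (Real.log ((n : ℝ) * (p n : ℝ)) / n) ≤ ε * |Θ n j k|)
    -- for each `n`, an i.i.d. sample of size `n` from the Ising model
    {Ω : ℕ → Type*} [∀ n, MeasurableSpace (Ω n)]
    (P : ∀ n, Measure (Ω n)) [∀ n, IsProbabilityMeasure (P n)]
    (X : ∀ n, Fin n → Ω n → (Fin (p n) → Fin 2))
    (hmeas : ∀ n i, Measurable (X n i))
    (hindep : ∀ n, iIndepFun (X n) (P n))
    (hlaw : ∀ n i x, (P n).real {ω | X n i ω = x} = isingProb (ζ n) (Θ n) x) :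
    -- the case `κ > 0`
    (kappa p ≠ 0 → ∀ α β γ : ℝ,
      1 - invKappa p / 2 + β + α * invKappa p < γ →
      (α < 1 / 2 ∨ Tendsto (kappaSeq p) atTop (𝓝 (kappa p))) →
      ∀ᶠ n : ℕ in atTop,
        1 - (n : ℝ) ^ (-α) * (p n : ℝ) ^ (-(β - 1)) ≤
          (P n).real {ω | BeatsBy γ q (fun i => X n i ω) (neighborhood (Θ n))
            (Real.log (p n) * (γ - (1 - invKappa p / 2 + β + α * invKappa p)))}) ∧
    -- the case `κ = 0`, in which the bracket above is `+∞`
    (kappa p = 0 → ∀ α β γ : ℝ, 0 < α → α < 1 / 2 → 0 < β → ∀ M : ℝ,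
      ∀ᶠ n : ℕ in atTop,
        1 - (n : ℝ) ^ (-α) * (p n : ℝ) ^ (-(β - 1)) ≤
          (P n).real {ω | BeatsBy γ q (fun i => X n i ω) (neighborhood (Θ n))
            (Real.log (p n) * M)}) ∧
    -- consistency
    (∀ γ : ℝ, (kappa p = 0 ∨ 2 - invKappa p / 2 < γ) →
      Tendsto (fun n : ℕ => (P n).real {ω | ∀ S : Fin (p n) → Finset (Fin (p n)),
          IsSelected γ q (fun i => X n i ω) S →
            (∀ j, S j = neighborhood (Θ n) j) ∧
            andGraph S = isingGraph (Θ n) ∧ orGraph S = isingGraph (Θ n)})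
        atTop (𝓝 1)) := by
  have sel : ∀ {α β γ K c₀ : ℝ} {μ : ℕ → ℝ}, 0 < c₀ → 0 ≤ K →
      (∀ᶠ n : ℕ in atTop, |μ n| ≤ K * (Real.log n + Real.log (p n))) →
      (∀ᶠ n : ℕ in atTop, 0 < α * Real.log n + (β - 1) * Real.log (p n) →
        ∀ r : ℕ, 1 ≤ r → r ≤ q →
          2 * α * Real.log n + 2 * β * Real.log (p n) + 2 * r * Real.log (p n)
              + c₀ * (Real.log n + Real.log (p n))
            ≤ r * (Real.log n + 2 * γ * Real.log (p n)) - μ n) →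
      ∀ᶠ n : ℕ in atTop, 1 - (n : ℝ) ^ (-α) * (p n : ℝ) ^ (-(β - 1)) ≤
        (P n).real {ω | BeatsBy γ q (fun i => X n i ω) (neighborhood (Θ n)) (μ n)} :=
    fun h1 h2 h3 h4 => eventually_le_measureReal_beatsBy hp hsymm hdiag hC1 hC2 hC3 hC4 hmeas
      hindep hlaw h1 h2 h3 h4
  have part1 : kappa p ≠ 0 → ∀ α β γ : ℝ,
      1 - invKappa p / 2 + β + α * invKappa p < γ →
      (α < 1 / 2 ∨ Tendsto (kappaSeq p) atTop (𝓝 (kappa p))) →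
      ∀ᶠ n : ℕ in atTop,
        1 - (n : ℝ) ^ (-α) * (p n : ℝ) ^ (-(β - 1)) ≤
          (P n).real {ω | BeatsBy γ q (fun i => X n i ω) (neighborhood (Θ n))
            (Real.log (p n) * (γ - (1 - invKappa p / 2 + β + α * invKappa p)))} := by
    intro hκ α β γ hγ hα
    set ε := γ - (1 - invKappa p / 2 + β + α * invKappa p) with hε
    have hε0 : 0 < ε := by rw [hε]; linarith
    obtain ⟨c₀, hc₀, hslack⟩ := exists_slack hκ hε0 hα
    refine sel hc₀ hε0.le (Eventually.of_forall fun n => ?_) ?_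
    · have hl := Real.log_natCast_nonneg n
      have hlp := Real.log_natCast_nonneg (p n)
      rw [abs_of_nonneg (mul_nonneg hlp hε0.le)]
      linarith [mul_nonneg hε0.le hl]
    · filter_upwards [hslack] with n hn hpos r hr _
      have hl := Real.log_natCast_nonneg n
      have hlp := Real.log_natCast_nonneg (p n)
      have hγε : γ = 1 - invKappa p / 2 + β + α * invKappa p + ε := by rw [hε]; ring
      generalize Real.log n = l at *
      generalize Real.log (p n) = lp at *
      have hL : 0 ≤ c₀ * (l + lp) := by positivity
      have hεlp : 0 ≤ ε * lp := by positivity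
      have hr' : (0 : ℝ) ≤ r - 1 := by
        have : (1 : ℝ) ≤ r := by exact_mod_cast hr
        linarith
      -- The case r = 1. The gap in γ yields 2 ε log p: one half is the margin μ, the other enters
      -- the slack.
      have hK : l + 2 * γ * lp = 2 * α * l + 2 * (1 + β) * lp + ε * lp
          + ((1 - 2 * α) * (l - invKappa p * lp) + ε * lp) := by rw [hγε]; ring
      -- Each further node adds this net penalty, whose sign is secured by `hpos`; hence r > 1
      -- follows from r = 1.
      have h1 : 0 ≤ l + 2 * γ * lp - 2 * lp := by linarith
      linarith [mul_nonneg hr' h1]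
  have part2 : kappa p = 0 → ∀ α β γ : ℝ, 0 < α → α < 1 / 2 → 0 < β → ∀ M : ℝ,
      ∀ᶠ n : ℕ in atTop,
        1 - (n : ℝ) ^ (-α) * (p n : ℝ) ^ (-(β - 1)) ≤
          (P n).real {ω | BeatsBy γ q (fun i => X n i ω) (neighborhood (Θ n))
            (Real.log (p n) * M)} := by
    intro hκ α β γ hα0 hα hβ M
    have hA : 0 < 1 - 2 * α := by linarith
    set c₀ := (1 - 2 * α) / 4 with hc₀
    have hc₀0 : 0 < c₀ := by positivity
    -- `D` collects the coefficients of log p at r = 1. Of (1 - 2α) log n = 4 c₀ log n, one part is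
    -- kept as slack and the other three dominate D log p, because κ = 0.
    set D := 2 * |γ| + 2 + |M| + 2 * β + c₀ with hD
    have hD0 : 0 < D := by positivity
    refine sel (K := |M|) hc₀0 (abs_nonneg M) (Eventually.of_forall fun n => ?_) ?_
    · have hl := Real.log_natCast_nonneg n
      have hlp := Real.log_natCast_nonneg (p n)
      rw [abs_mul, abs_of_nonneg hlp]
      linarith [mul_nonneg (abs_nonneg M) hl]
    · filter_upwards [eventually_log_le_of_kappa_lt (p := p) (t := 3 * c₀ / D) (by positivity)
        (by rw [hκ]; exact ENNReal.ofReal_pos.2 (by positivity))] with n hn _ r hr _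
      have hl := Real.log_natCast_nonneg n
      have hlp := Real.log_natCast_nonneg (p n)
      generalize Real.log n = l at *
      generalize Real.log (p n) = lp at *
      rw [div_mul_eq_mul_div, le_div_iff₀ hD0] at hn
      have hr' : (0 : ℝ) ≤ r - 1 := by
        have : (1 : ℝ) ≤ r := by exact_mod_cast hr
        linarith
      have h1 := mul_le_mul_of_nonneg_right (neg_abs_le γ) hlp
      have h2 := mul_le_mul_of_nonneg_right (le_abs_self M) hlp
      have h3 := mul_nonneg (abs_nonneg M) hlp
      have h4 := mul_nonneg hβ.le hlp
      have h5 := mul_nonneg hc₀0.le hlp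
      have h6 := mul_nonneg hα0.le hl
      have h7 : lp * D = 2 * (|γ| * lp) + 2 * lp + |M| * lp + 2 * (β * lp) + c₀ * lp := by
        rw [hD]; ring
      have h8 : 4 * (c₀ * l) = l - 2 * (α * l) := by rw [hc₀]; ring
      have h9 : 0 ≤ l + 2 * γ * lp - 2 * lp := by
        have := mul_nonneg hc₀0.le hl
        linarith
      linarith [mul_nonneg hr' h9]
  refine ⟨part1, part2, fun γ hγ => ?_⟩
  -- Consistency uses β = 1, which removes the factor in p, and a small α > 0 that still fits under
  -- γ, so the failure probability is at most n^(-α).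
  obtain ⟨α, hα, μ, hμ, hev⟩ : ∃ α : ℝ, 0 < α ∧ ∃ μ : ℕ → ℝ, (∀ n, 0 ≤ μ n) ∧
      ∀ᶠ n : ℕ in atTop, 1 - (n : ℝ) ^ (-α) ≤
        (P n).real {ω | BeatsBy γ q (fun i => X n i ω) (neighborhood (Θ n)) (μ n)} := by
    by_cases hκ : kappa p = 0
    · refine ⟨1 / 4, by norm_num, fun n => Real.log (p n) * 0, fun n => by simp, ?_⟩
      simpa using part2 hκ (1 / 4) 1 γ (by norm_num) (by norm_num) one_pos 0
    · have hγ' := hγ.resolve_left hκ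
      have hik : 0 ≤ invKappa p := ENNReal.toReal_nonneg
      set δ := γ - (2 - invKappa p / 2) with hδ
      have hδ0 : 0 < δ := by rw [hδ]; linarith
      set α := min (1 / 4) (δ / (2 * (invKappa p + 1))) with hα
      have hα0 : 0 < α := lt_min (by norm_num) (by positivity)
      have hαδ : α * invKappa p < δ := by
        have h1 := min_le_right (1 / 4) (δ / (2 * (invKappa p + 1)))
        rw [← hα, le_div_iff₀ (by positivity)] at h1
        nlinarith
      have hlt : 1 - invKappa p / 2 + 1 + α * invKappa p < γ := by linarith
      refine ⟨α, hα0, _, fun n => mul_nonneg (Real.log_natCast_nonneg (p n)) (sub_nonneg.2 hlt.le), ?_⟩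
      simpa using part1 hκ α 1 γ hlt
        (Or.inl (lt_of_le_of_lt (min_le_left _ _) (by norm_num)))
  have hlim : Tendsto (fun n : ℕ => 1 - (n : ℝ) ^ (-α)) atTop (𝓝 1) := by
    simpa using ((tendsto_rpow_neg_atTop hα).comp tendsto_natCast_atTop_atTop).const_sub 1
  refine tendsto_of_tendsto_of_tendsto_of_le_of_le' hlim tendsto_const_nhds ?_
    (Eventually.of_forall fun n => measureReal_le_one)
  filter_upwards [hev] with n hn
  refine hn.trans (measureReal_mono fun ω hω S hS => ?_)
  obtain rfl := hS.eq_neighborhood (hC2 n) (hμ n) hω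
  exact ⟨fun _ => rfl, andGraph_neighborhood (hsymm n), orGraph_neighborhood (hsymm n)⟩
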